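/- **Theorem 1.** All systems are finite-dimensional (dimension at least $1$). Alice holds the systems called $A$, Bob those called $B$ (primed or not); $A_0,B_0$ denote inputs and $A_1,B_1$ outputs. A bipartite channel is a completely positive trace-preserving map $\mathcal N:A_0B_0\to A_1B_1$, with Choi matrix $J^{\mathcal N}=\sum_{i,j}|i\rangle\langle j|\otimes\mathcal N(|i\rangle\langle j|)$. An LOCC channel is one implemented by finitely many rounds of local quantum instruments whose outcomes are communicated to the other party, ending with local channels. An LOCC superchannel is a linear supermap of the form $\Theta[\mathcal N]=\mathcal F\circ(\mathcal N\otimes\mathrm{id}_{A_2B_2})\circ\mathcal E$, where $A_2$ and $B_2$ are memory systems of Alice and of Bob, and $\mathcal E:A_0'B_0'\to (A_0A_2)(B_0B_2)$ and $\mathcal F:(A_1A_2)(B_1B_2)\to A_1'B_1'$ are LOCC channels. For bipartite channels $\mathcal P$ and $\mathcal N$ put $$E_{\mathcal P}(\mathcal N)=\sup_{\Theta\ \mathrm{LOCC}}\mathrm{Tr}\left[J^{\mathcal P}J^{\Theta[\mathcal N]}\right],$$ the supremum being over the LOCC superchannels $\Theta$ for which $\Theta[\mathcal N]$ has the input and output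 systems of $\mathcal P$. We say that $\mathcal N$ *can be LOCC-converted* into $\mathcal M$ if $\mathcal M=\Theta[\mathcal N]$ for some $\Theta$ in the topological closure of the set of LOCC superchannels. 1. For every bipartite channel $\mathcal P$ and every choice of systems, the function $E_{\mathcal P}$ is finite and convex on bipartite channels, and $E_{\mathcal P}(\Theta[\mathcal N])\le E_{\mathcal P}(\mathcal N)$ for every LOCC superchannel $\Theta$ and every bipartite channel $\mathcal N$. 2. For all bipartite channels $\mathcal N$ and $\mathcal M$ (possibly between different systems), $\mathcal N$ can be LOCC-converted into $\mathcal M$ if and only if $E_{\mathcal P}(\mathcal N)\ge E_{\mathcal P}(\mathcal M)$ for every bipartite channel $\mathcal P$. It is also equivalent that this inequality holds for every bipartite channel $\mathcal P$ with the same input and output systems as $\mathcal M$. -/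

import Mathlib

open Filter Topology
open scoped Kronecker

/-- A finite-dimensional quantum system `ℂ^d`, `d ≥ 1`, given by the (finite, nonempty) index
set of its computational basis. -/
structure QSys : Type 1 where
  Idx : Type
  [fin : Fintype Idx]
  [dec : DecidableEq Idx]
  [ne : Nonempty Idx]

namespace QSys

attribute [instance] QSys.fin QSys.dec QSys.ne

/-- The composite system `A ⊗ B`. -/
abbrev tensor (A B : QSys) : QSys := ⟨A.Idx × B.Idx⟩

/-- Operators on the Hilbert space of `A`. -/
abbrev Op (A : QSys) : Type := Matrix A.Idx A.Idx ℂ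

/-- Linear maps from operators on `A` to operators on `B`. -/
abbrev Map (A B : QSys) : Type := A.Op →ₗ[ℂ] B.Op

/-- Linear supermaps, from linear maps `A₀ → A₁` to linear maps `C₀ → C₁`. -/
abbrev SMap (A₀ A₁ C₀ C₁ : QSys) : Type := Map A₀ A₁ →ₗ[ℂ] Map C₀ C₁

end QSys

namespace DynEnt

open QSys

/-- The tensor product `Φ ⊗ Ψ` of two linear maps, expanded in matrix units. -/
def tensorMap {A A' B B' : QSys} (Φ : Map A A') (Ψ : Map B B') :
    Map (A.tensor B) (A'.tensor B') where
  toFun X := ∑ i, ∑ j, ∑ k, ∑ l,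
    X (i, k) (j, l) • (Φ (Matrix.single i j 1) ⊗ₖ Ψ (Matrix.single k l 1))
  map_add' X Y := by
    simp only [Matrix.add_apply, add_smul, Finset.sum_add_distrib]
  map_smul' c X := by
    simp only [Matrix.smul_apply, smul_eq_mul, mul_smul, Finset.smul_sum, RingHom.id_apply]

/-- `Φ ⊗ Ψ` acts on product operators as expected. -/
theorem tensorMap_kronecker {A A' B B' : QSys} (Φ : Map A A') (Ψ : Map B B')
    (X : A.Op) (Y : B.Op) : tensorMap Φ Ψ (X ⊗ₖ Y) = Φ X ⊗ₖ Ψ Y := by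
  conv_rhs => rw [Matrix.matrix_eq_sum_single X, Matrix.matrix_eq_sum_single Y]
  have h : ∀ (n : QSys) (i j : n.Idx) (x : ℂ),
      (Matrix.single i j x : n.Op) = x • Matrix.single i j 1 := by
    intro n i j x; simp [Matrix.smul_single]
  ext ⟨a, b⟩ ⟨c, d⟩
  simp only [h _ _ _ (X _ _), h _ _ _ (Y _ _), map_sum, map_smul, tensorMap, LinearMap.coe_mk,
    AddHom.coe_mk, Matrix.sum_apply, Matrix.smul_apply, Matrix.kroneckerMap_apply, smul_eq_mul,
    Finset.sum_mul]
  refine Finset.sum_congr rfl fun i _ => Finset.sum_congr rfl fun j _ => ?_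
  rw [Finset.mul_sum]
  refine Finset.sum_congr rfl fun k _ => ?_
  rw [Finset.mul_sum]
  refine Finset.sum_congr rfl fun l _ => ?_
  ring

open scoped ComplexOrder in
/-- Complete positivity: `id_R ⊗ Φ` preserves positive semidefiniteness for every `R`. -/
def IsCP {A B : QSys} (Φ : Map A B) : Prop :=
  ∀ (R : QSys) (X : (R.tensor A).Op), X.PosSemidef →
    (tensorMap (LinearMap.id : Map R R) Φ X).PosSemidef

/-- Trace preservation. -/
def IsTP {A B : QSys} (Φ : Map A B) : Prop :=
  ∀ X : A.Op, (Φ X).trace = X.trace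

/-- A quantum channel is a completely positive trace-preserving map. -/
def IsChannel {A B : QSys} (Φ : Map A B) : Prop := IsCP Φ ∧ IsTP Φ

/-- A quantum instrument with finitely many outcomes. -/
def IsInstrument {A B : QSys} {J : Type} [Fintype J] (F : J → Map A B) : Prop :=
  (∀ j, IsCP (F j)) ∧ IsTP (∑ j, F j)

/-- LOCC channels from `A B` to `A' B'` (Alice holds the first factor, Bob the second):
protocols with finitely many rounds. Either the two parties apply local channels and stop, or
one of them applies a local instrument, announces the outcome `j` to the other, and they
continue with an LOCC protocol that may depend on `j`. -/
inductive IsLOCC {A' B' : QSys} :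
    {A B : QSys} → Map (A.tensor B) (A'.tensor B') → Prop
  | product {A B : QSys} (Φ : Map A A') (Ψ : Map B B')
      (hΦ : IsChannel Φ) (hΨ : IsChannel Ψ) : IsLOCC (tensorMap Φ Ψ)
  | alice {A B C : QSys} {J : Type} [Fintype J] (F : J → Map A C)
      (L : J → Map (C.tensor B) (A'.tensor B'))
      (hF : IsInstrument F) (hL : ∀ j, IsLOCC (L j)) :
      IsLOCC (∑ j, L j ∘ₗ tensorMap (F j) (LinearMap.id : Map B B))
  | bob {A B C : QSys} {J : Type} [Fintype J] (F : J → Map B C)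
      (L : J → Map (A.tensor C) (A'.tensor B'))
      (hF : IsInstrument F) (hL : ∀ j, IsLOCC (L j)) :
      IsLOCC (∑ j, L j ∘ₗ tensorMap (LinearMap.id : Map A A) (F j))

/-- The regrouping of tensor factors `(A B) (C D) → (A C) (B D)`. -/
def regroup (A B C D : QSys) :
    Map ((A.tensor B).tensor (C.tensor D)) ((A.tensor C).tensor (B.tensor D)) :=
  (Matrix.reindexLinearEquiv ℂ ℂ
    (Equiv.prodProdProdComm A.Idx B.Idx C.Idx D.Idx)
    (Equiv.prodProdProdComm A.Idx B.Idx C.Idx D.Idx)).toLinearMap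

/-- `Θ` is an LOCC superchannel from bipartite channels `A₀ B₀ → A₁ B₁` to bipartite channels
`C₀ D₀ → C₁ D₁` (Alice holds the `A`s and `C`s): it consists of an LOCC preprocessing `pre`
and an LOCC postprocessing `post`, connected by a memory `A₂` of Alice and a memory `B₂` of Bob,
`Θ[N] = post ∘ (N ⊗ id_{A₂ B₂}) ∘ pre`. -/
def IsLOCCSuperchannel {A₀ A₁ B₀ B₁ C₀ C₁ D₀ D₁ : QSys}
    (Θ : SMap (A₀.tensor B₀) (A₁.tensor B₁) (C₀.tensor D₀) (C₁.tensor D₁)) : Prop :=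
  ∃ (A₂ B₂ : QSys)
    (pre : Map (C₀.tensor D₀) ((A₀.tensor A₂).tensor (B₀.tensor B₂)))
    (post : Map ((A₁.tensor A₂).tensor (B₁.tensor B₂)) (C₁.tensor D₁)),
    IsLOCC pre ∧ IsLOCC post ∧
      ∀ N : Map (A₀.tensor B₀) (A₁.tensor B₁),
        Θ N = post ∘ₗ regroup A₁ B₁ A₂ B₂ ∘ₗ
          tensorMap N (LinearMap.id : Map (A₂.tensor B₂) (A₂.tensor B₂)) ∘ₗ
            regroup A₀ A₂ B₀ B₂ ∘ₗ pre

/-- `Θ` lies in the topological closure of the set of LOCC superchannels. The space of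
supermaps of a given type is finite-dimensional, so convergence is tested pointwise. -/
def IsClosureLOCCSuperchannel {A₀ A₁ B₀ B₁ C₀ C₁ D₀ D₁ : QSys}
    (Θ : SMap (A₀.tensor B₀) (A₁.tensor B₁) (C₀.tensor D₀) (C₁.tensor D₁)) : Prop :=
  ∃ Ξ : ℕ → SMap (A₀.tensor B₀) (A₁.tensor B₁) (C₀.tensor D₀) (C₁.tensor D₁),
    (∀ n, IsLOCCSuperchannel (Ξ n)) ∧
      ∀ (N : Map (A₀.tensor B₀) (A₁.tensor B₁)) (X : (C₀.tensor D₀).Op),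
        Tendsto (fun n => Ξ n N X) atTop (𝓝 (Θ N X))

/-- `N` can be LOCC-converted into `M`: some superchannel in the topological closure of the LOCC
superchannels sends `N` to `M`. -/
def LOCCConvertible {A₀ A₁ B₀ B₁ C₀ C₁ D₀ D₁ : QSys}
    (N : Map (A₀.tensor B₀) (A₁.tensor B₁)) (M : Map (C₀.tensor D₀) (C₁.tensor D₁)) : Prop :=
  ∃ Θ : SMap (A₀.tensor B₀) (A₁.tensor B₁) (C₀.tensor D₀) (C₁.tensor D₁),
    IsClosureLOCCSuperchannel Θ ∧ Θ N = M

/-- The Choi matrix `J^Φ = ∑_{ij} |i⟩⟨j| ⊗ Φ(|i⟩⟨j|)`. -/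
def choi {A B : QSys} (Φ : Map A B) : (A.tensor B).Op :=
  ∑ i, ∑ j, (Matrix.single i j 1 : A.Op) ⊗ₖ Φ (Matrix.single i j 1)

/-- The values `Tr[J^P J^{Θ[N]}]`, `Θ` an LOCC superchannel. (The trace is real for channels `P`,
`N`.) -/
def values {A₀ A₁ B₀ B₁ C₀ C₁ D₀ D₁ : QSys}
    (P : Map (C₀.tensor D₀) (C₁.tensor D₁)) (N : Map (A₀.tensor B₀) (A₁.tensor B₁)) : Set ℝ :=
  {x | ∃ Θ : SMap (A₀.tensor B₀) (A₁.tensor B₁) (C₀.tensor D₀) (C₁.tensor D₁),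
    IsLOCCSuperchannel Θ ∧ x = ((choi P * choi (Θ N)).trace).re}

/-- `E_P(N) = sup_{Θ LOCC} Tr[J^P J^{Θ[N]}]`. -/
noncomputable def E {A₀ A₁ B₀ B₁ C₀ C₁ D₀ D₁ : QSys}
    (P : Map (C₀.tensor D₀) (C₁.tensor D₁)) (N : Map (A₀.tensor B₀) (A₁.tensor B₁)) : ℝ :=
  sSup (values P N)

end DynEnt

/-!
The supremum defining `E P N` runs over the LOCC superchannels, so everything rests on three
properties of that set: it is closed under composition, convex, and bounded.

* Closure under composition (`IsLOCCSuperchannel.comp`) gives monotonicity, since every value of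
  `P` on `Θ N` is then a value on `N`. It reduces to LOCC channels being closed under composition
  and under adjoining local memories, both by induction on the protocol.
* Convexity (`isLOCCSuperchannel_mix`) uses shared randomness: the branch of a mixture is drawn
  before the preprocessing, kept by both parties as the summand of a direct sum in which their
  memories live, and read off before the postprocessing.
* Boundedness (`exists_bound`) follows from positivity: a completely positive `Φ` is dominated by a
  multiple of the depolarizing channel, hence so is its image under any LOCC superchannel, and
  completely positive maps span all linear maps. This gives finiteness of `E P`.

The function `E P` is convex as a supremum of linear functions, and by continuity and monotonicity
it does not increase under limits of LOCC superchannels (`LOCCConvertible.E_le`).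

For the converse, the closure of the set of LOCC superchannels is compact and convex
(`isCompact_loccClosure`, `convex_loccClosure`), so the same is true of the set of maps reached from
`N`. If `M` is not among them, Hahn–Banach separates it by a functional `X ↦ Re Tr[W X]` on Choi
matrices. On Choi matrices of channels `W` may be taken Hermitian, and up to a positive factor and
an additive constant it may be replaced by the Choi matrix of a channel `P`
(`exists_isChannel_trace_mul_choi`). Then `E P N < E P M`, because the identity is an LOCC
superchannel.
-/

namespace DynEnt

open QSys

/-! ### Tensor products of linear maps -/

/-- The Kronecker product of operators, typed as an operator on the composite system
`A.tensor B` rather than as a matrix indexed by the product type. -/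
def kron {A B : QSys} (X : A.Op) (Y : B.Op) : (A.tensor B).Op := X ⊗ₖ Y

theorem kron_apply {A B : QSys} (X : A.Op) (Y : B.Op) (p q : A.Idx × B.Idx) :
    kron X Y p q = X p.1 q.1 * Y p.2 q.2 := rfl

theorem tensorMap_kron {A A' B B' : QSys} (Φ : Map A A') (Ψ : Map B B')
    (X : A.Op) (Y : B.Op) : tensorMap Φ Ψ (kron X Y) = kron (Φ X) (Ψ Y) :=
  tensorMap_kronecker Φ Ψ X Y

/-- The matrix unit `|i⟩⟨j|`. -/
def matUnit (A : QSys) (i j : A.Idx) : A.Op := Matrix.single i j 1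

theorem matUnit_tensor {A B : QSys} (p q : (A.tensor B).Idx) :
    matUnit (A.tensor B) p q = kron (matUnit A p.1 q.1) (matUnit B p.2 q.2) := by
  simp only [kron, matUnit]
  rw [Matrix.single_kronecker_single, one_mul]

theorem map_ext_matUnit {A B : QSys} {Φ Ψ : Map A B}
    (h : ∀ i j, Φ (matUnit A i j) = Ψ (matUnit A i j)) : Φ = Ψ :=
  Matrix.ext_linearMap ℂ fun i j => LinearMap.ext_ring (h i j)

/-- A linear map on a composite system is determined by its values on product operators. -/
theorem map_ext_kron {A B C : QSys} {Φ Ψ : Map (A.tensor B) C}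
    (h : ∀ (X : A.Op) (Y : B.Op), Φ (kron X Y) = Ψ (kron X Y)) : Φ = Ψ :=
  map_ext_matUnit fun p q => by
    rw [matUnit_tensor]; exact h _ _

theorem map_ext_kron₄ {A B C D T : QSys}
    {Φ Ψ : Map ((A.tensor B).tensor (C.tensor D)) T}
    (h : ∀ (X : A.Op) (Y : B.Op) (Z : C.Op) (W : D.Op),
      Φ (kron (kron X Y) (kron Z W)) = Ψ (kron (kron X Y) (kron Z W))) : Φ = Ψ :=
  map_ext_matUnit fun p q => by
    rw [matUnit_tensor, matUnit_tensor, matUnit_tensor]; exact h _ _ _ _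

theorem add_kron {A B : QSys} (X X' : A.Op) (Y : B.Op) :
    kron (X + X') Y = kron X Y + kron X' Y := Matrix.add_kronecker X X' Y

theorem smul_kron {A B : QSys} (c : ℂ) (X : A.Op) (Y : B.Op) :
    kron (c • X) Y = c • kron X Y := Matrix.smul_kronecker c X Y

theorem kron_add {A B : QSys} (X : A.Op) (Y Y' : B.Op) :
    kron X (Y + Y') = kron X Y + kron X Y' := Matrix.kronecker_add X Y Y'

theorem kron_smul {A B : QSys} (c : ℂ) (X : A.Op) (Y : B.Op) :
    kron X (c • Y) = c • kron X Y := Matrix.kronecker_smul c X Y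

/-- `tensorMap` as a bilinear map. -/
def tensorMapₗ (A A' B B' : QSys) :
    Map A A' →ₗ[ℂ] Map B B' →ₗ[ℂ] Map (A.tensor B) (A'.tensor B') :=
  LinearMap.mk₂ ℂ tensorMap
    (fun Φ Φ' Ψ => map_ext_kron fun X Y => by
      simp only [tensorMap_kron, LinearMap.add_apply, add_kron])
    (fun c Φ Ψ => map_ext_kron fun X Y => by
      simp only [tensorMap_kron, LinearMap.smul_apply, smul_kron])
    (fun Φ Ψ Ψ' => map_ext_kron fun X Y => by
      simp only [tensorMap_kron, LinearMap.add_apply, kron_add])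
    (fun c Φ Ψ => map_ext_kron fun X Y => by
      simp only [tensorMap_kron, LinearMap.smul_apply, kron_smul])

theorem tensorMap_sum_left {A A' B B' : QSys} {J : Type} [Fintype J] (F : J → Map A A')
    (Ψ : Map B B') : tensorMap (∑ j, F j) Ψ = ∑ j, tensorMap (F j) Ψ :=
  (map_sum ((tensorMapₗ A A' B B').flip Ψ) F Finset.univ)

theorem tensorMap_sum_right {A A' B B' : QSys} {J : Type} [Fintype J] (Φ : Map A A')
    (F : J → Map B B') : tensorMap Φ (∑ j, F j) = ∑ j, tensorMap Φ (F j) :=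
  (map_sum (tensorMapₗ A A' B B' Φ) F Finset.univ)

theorem tensorMap_smul_left {A A' B B' : QSys} (c : ℂ) (Φ : Map A A') (Ψ : Map B B') :
    tensorMap (c • Φ) Ψ = c • tensorMap Φ Ψ :=
  (tensorMapₗ A A' B B').map_smul₂ c Φ Ψ

theorem tensorMap_zero_left {A A' B B' : QSys} (Ψ : Map B B') :
    tensorMap (0 : Map A A') Ψ = 0 :=
  (tensorMapₗ A A' B B').map_zero₂ Ψ

theorem tensorMap_zero_right {A A' B B' : QSys} (Φ : Map A A') :
    tensorMap Φ (0 : Map B B') = 0 :=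
  (tensorMapₗ A A' B B' Φ).map_zero

theorem tensorMap_comp {A A' A'' B B' B'' : QSys} (Φ : Map A A') (Φ' : Map A' A'')
    (Ψ : Map B B') (Ψ' : Map B' B'') :
    tensorMap Φ' Ψ' ∘ₗ tensorMap Φ Ψ = tensorMap (Φ' ∘ₗ Φ) (Ψ' ∘ₗ Ψ) :=
  map_ext_kron fun X Y => by simp only [LinearMap.comp_apply, tensorMap_kron]

theorem tensorMap_id {A B : QSys} :
    tensorMap (LinearMap.id : Map A A) (LinearMap.id : Map B B) = LinearMap.id :=
  map_ext_kron fun X Y => by simp only [tensorMap_kron, LinearMap.id_apply]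

/-- The isomorphism of operator spaces induced by a bijection of computational bases. -/
def relabel {A B : QSys} (e : A.Idx ≃ B.Idx) : Map A B :=
  (Matrix.reindexLinearEquiv ℂ ℂ e e).toLinearMap

theorem relabel_apply {A B : QSys} (e : A.Idx ≃ B.Idx) (X : A.Op) :
    relabel e X = X.submatrix e.symm e.symm := rfl

theorem relabel_symm_comp {A B : QSys} (e : A.Idx ≃ B.Idx) :
    relabel e.symm ∘ₗ relabel e = (LinearMap.id : Map A A) := by
  ext X i j; simp [relabel_apply]

theorem tensorMap_relabel {A A' B B' : QSys} (e : A.Idx ≃ A'.Idx) (f : B.Idx ≃ B'.Idx) :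
    tensorMap (relabel e) (relabel f)
      = relabel (A := A.tensor B) (B := A'.tensor B') (e.prodCongr f) :=
  map_ext_kron fun X Y => by
    rw [tensorMap_kron]; ext ⟨a, b⟩ ⟨c, d⟩; rfl

/-- `R ⊗ (S ⊗ Φ)` is `(R ⊗ S) ⊗ Φ` up to reassociation of the factors. -/
theorem relabel_comp_id_tensorMap {R S B B' : QSys} (Φ : Map B B') :
    relabel (A := R.tensor (S.tensor B')) (B := (R.tensor S).tensor B')
        (Equiv.prodAssoc R.Idx S.Idx B'.Idx).symm ∘ₗ
      tensorMap (LinearMap.id : Map R R) (tensorMap (LinearMap.id : Map S S) Φ) =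
    tensorMap (LinearMap.id : Map (R.tensor S) (R.tensor S)) Φ ∘ₗ
      relabel (A := R.tensor (S.tensor B)) (B := (R.tensor S).tensor B)
        (Equiv.prodAssoc R.Idx S.Idx B.Idx).symm := by
  have h : ∀ B : QSys, ∀ (X : R.Op) (Y : S.Op) (Z : B.Op),
      relabel (A := R.tensor (S.tensor B)) (B := (R.tensor S).tensor B)
        (Equiv.prodAssoc R.Idx S.Idx B.Idx).symm (kron X (kron Y Z)) = kron (kron X Y) Z := by
    intro B X Y Z; ext ⟨⟨a, b⟩, c⟩ ⟨⟨a', b'⟩, c'⟩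
    exact (mul_assoc _ _ _).symm
  refine map_ext_matUnit fun p q => ?_
  rw [matUnit_tensor, matUnit_tensor]
  simp only [LinearMap.comp_apply, h, tensorMap_kron, LinearMap.id_apply]

theorem relabel_swap_comp_tensorMap {A A' B B' : QSys} (Φ : Map A A') (Ψ : Map B B') :
    relabel (A := A'.tensor B') (B := B'.tensor A') (Equiv.prodComm A'.Idx B'.Idx) ∘ₗ
      tensorMap Φ Ψ =
    tensorMap Ψ Φ ∘ₗ
      relabel (A := A.tensor B) (B := B.tensor A) (Equiv.prodComm A.Idx B.Idx) := by
  have h : ∀ (A B : QSys) (X : A.Op) (Y : B.Op),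
      relabel (A := A.tensor B) (B := B.tensor A) (Equiv.prodComm A.Idx B.Idx) (kron X Y)
        = kron Y X := by
    intro A B X Y; ext ⟨a, b⟩ ⟨c, d⟩; exact mul_comm _ _
  exact map_ext_kron fun X Y => by
    simp only [LinearMap.comp_apply, tensorMap_kron, h]

/-! ### Adjoining local memories -/

theorem regroup_kron {A B C D : QSys} (X : A.Op) (Y : B.Op) (Z : C.Op) (W : D.Op) :
    regroup A B C D (kron (kron X Y) (kron Z W)) = kron (kron X Z) (kron Y W) := by
  ext ⟨⟨a, b⟩, c, d⟩ ⟨⟨a', b'⟩, c', d'⟩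
  exact mul_mul_mul_comm _ _ _ _

theorem regroup_comp_regroup (A B C D : QSys) :
    regroup A C B D ∘ₗ regroup A B C D = LinearMap.id :=
  map_ext_kron₄ fun X Y Z W => by
    simp only [LinearMap.comp_apply, regroup_kron, LinearMap.id_apply]

theorem regroup_comp_tensorMap {A B C D A' B' C' D' : QSys} (f : Map A A') (g : Map B B')
    (h : Map C C') (k : Map D D') :
    regroup A' B' C' D' ∘ₗ tensorMap (tensorMap f g) (tensorMap h k) =
      tensorMap (tensorMap f h) (tensorMap g k) ∘ₗ regroup A B C D :=
  map_ext_kron₄ fun X Y Z W => by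
    simp only [LinearMap.comp_apply, regroup_kron, tensorMap_kron]

/-- The bipartite map `N ⊗ id` with a memory `A₂` of Alice and a memory `B₂` of Bob, the factors
being ordered so that each party's systems are adjacent. -/
def withMemory {A₀ A₁ B₀ B₁ : QSys} (A₂ B₂ : QSys) (N : Map (A₀.tensor B₀) (A₁.tensor B₁)) :
    Map ((A₀.tensor A₂).tensor (B₀.tensor B₂)) ((A₁.tensor A₂).tensor (B₁.tensor B₂)) :=
  regroup A₁ B₁ A₂ B₂ ∘ₗ
    tensorMap N (LinearMap.id : Map (A₂.tensor B₂) (A₂.tensor B₂)) ∘ₗ regroup A₀ A₂ B₀ B₂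

theorem comp_sum {A B C : QSys} {J : Type} [Fintype J] (Φ : Map B C) (F : J → Map A B) :
    Φ ∘ₗ ∑ j, F j = ∑ j, Φ ∘ₗ F j := by
  ext1 X; simp only [LinearMap.comp_apply, LinearMap.sum_apply, map_sum]

theorem sum_comp {A B C : QSys} {J : Type} [Fintype J] (F : J → Map B C) (Φ : Map A B) :
    (∑ j, F j) ∘ₗ Φ = ∑ j, F j ∘ₗ Φ := by
  ext1 X; simp only [LinearMap.comp_apply, LinearMap.sum_apply]

section withMemory

variable {A₀ A₁ B₀ B₁ : QSys} (A₂ B₂ : QSys)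

theorem withMemory_comp {C₁ D₁ : QSys} (N : Map (A₀.tensor B₀) (A₁.tensor B₁))
    (M : Map (A₁.tensor B₁) (C₁.tensor D₁)) :
    withMemory A₂ B₂ (M ∘ₗ N) = withMemory A₂ B₂ M ∘ₗ withMemory A₂ B₂ N := by
  have h : tensorMap (M ∘ₗ N) (LinearMap.id : Map (A₂.tensor B₂) (A₂.tensor B₂)) =
      tensorMap M LinearMap.id ∘ₗ (regroup A₁ A₂ B₁ B₂ ∘ₗ regroup A₁ B₁ A₂ B₂) ∘ₗ
        tensorMap N LinearMap.id := by
    rw [regroup_comp_regroup, LinearMap.id_comp, tensorMap_comp, LinearMap.id_comp]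
  rw [withMemory, h]; rfl

theorem withMemory_tensorMap (Φ : Map A₀ A₁) (Ψ : Map B₀ B₁) :
    withMemory A₂ B₂ (tensorMap Φ Ψ) =
      tensorMap (tensorMap Φ (LinearMap.id : Map A₂ A₂))
        (tensorMap Ψ (LinearMap.id : Map B₂ B₂)) :=
  map_ext_kron₄ fun X Y Z W => by
    simp only [withMemory, LinearMap.comp_apply, regroup_kron, tensorMap_kron,
      LinearMap.id_apply]

theorem withMemory_sum {J : Type} [Fintype J] (N : J → Map (A₀.tensor B₀) (A₁.tensor B₁)) :
    withMemory A₂ B₂ (∑ j, N j) = ∑ j, withMemory A₂ B₂ (N j) := by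
  simp only [withMemory, tensorMap_sum_left, sum_comp, comp_sum]

theorem withMemory_add (N N' : Map (A₀.tensor B₀) (A₁.tensor B₁)) :
    withMemory A₂ B₂ (N + N') = withMemory A₂ B₂ N + withMemory A₂ B₂ N' := by
  have := (tensorMapₗ _ _ _ _).map_add₂ N N' (LinearMap.id : Map (A₂.tensor B₂) (A₂.tensor B₂))
  simp only [tensorMapₗ, LinearMap.mk₂_apply] at this
  simp only [withMemory, this, LinearMap.add_comp, LinearMap.comp_add]

theorem withMemory_smul (c : ℂ) (N : Map (A₀.tensor B₀) (A₁.tensor B₁)) :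
    withMemory A₂ B₂ (c • N) = c • withMemory A₂ B₂ N := by
  simp only [withMemory, tensorMap_smul_left, LinearMap.smul_comp, LinearMap.comp_smul]

variable {A₂ B₂}

/-- Operations on the memories commute with the map applied to the main systems. -/
theorem withMemory_comp_memory {A₃ B₃ : QSys} (N : Map (A₀.tensor B₀) (A₁.tensor B₁))
    (f : Map A₂ A₃) (g : Map B₂ B₃) :
    withMemory A₃ B₃ N ∘ₗ tensorMap (tensorMap (LinearMap.id : Map A₀ A₀) f)
        (tensorMap (LinearMap.id : Map B₀ B₀) g) =
      tensorMap (tensorMap (LinearMap.id : Map A₁ A₁) f)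
        (tensorMap (LinearMap.id : Map B₁ B₁) g) ∘ₗ withMemory A₂ B₂ N := by
  calc _ = regroup A₁ B₁ A₃ B₃ ∘ₗ tensorMap N LinearMap.id ∘ₗ (regroup A₀ A₃ B₀ B₃ ∘ₗ
        tensorMap (tensorMap (LinearMap.id : Map A₀ A₀) f)
          (tensorMap (LinearMap.id : Map B₀ B₀) g)) := rfl
    _ = regroup A₁ B₁ A₃ B₃ ∘ₗ (tensorMap N LinearMap.id ∘ₗ
          tensorMap LinearMap.id (tensorMap f g)) ∘ₗ regroup A₀ A₂ B₀ B₂ := by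
      rw [regroup_comp_tensorMap, tensorMap_id]; rfl
    _ = regroup A₁ B₁ A₃ B₃ ∘ₗ (tensorMap (tensorMap LinearMap.id LinearMap.id)
          (tensorMap f g) ∘ₗ tensorMap N LinearMap.id) ∘ₗ regroup A₀ A₂ B₀ B₂ := by
      rw [tensorMap_comp, tensorMap_id, tensorMap_comp]; rfl
    _ = (regroup A₁ B₁ A₃ B₃ ∘ₗ tensorMap (tensorMap LinearMap.id LinearMap.id)
          (tensorMap f g)) ∘ₗ tensorMap N LinearMap.id ∘ₗ regroup A₀ A₂ B₀ B₂ := rfl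
    _ = _ := by rw [regroup_comp_tensorMap]; rfl

/-- Adjoining memories twice is the same as adjoining the composite memories at once. -/
theorem withMemory_withMemory {A₃ B₃ : QSys} (N : Map (A₀.tensor B₀) (A₁.tensor B₁)) :
    withMemory A₃ B₃ (withMemory A₂ B₂ N) =
      tensorMap
        (relabel (A := A₁.tensor (A₂.tensor A₃)) (B := (A₁.tensor A₂).tensor A₃)
          (Equiv.prodAssoc A₁.Idx A₂.Idx A₃.Idx).symm)
        (relabel (A := B₁.tensor (B₂.tensor B₃)) (B := (B₁.tensor B₂).tensor B₃)
          (Equiv.prodAssoc B₁.Idx B₂.Idx B₃.Idx).symm) ∘ₗ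
      withMemory (A₂.tensor A₃) (B₂.tensor B₃) N ∘ₗ
      tensorMap
        (relabel (A := (A₀.tensor A₂).tensor A₃) (B := A₀.tensor (A₂.tensor A₃))
          (Equiv.prodAssoc A₀.Idx A₂.Idx A₃.Idx))
        (relabel (A := (B₀.tensor B₂).tensor B₃) (B := B₀.tensor (B₂.tensor B₃))
          (Equiv.prodAssoc B₀.Idx B₂.Idx B₃.Idx)) := by
  have key : ∀ (Z : (A₁.tensor B₁).Op) (a : A₂.Op) (b : B₂.Op) (c : A₃.Op) (d : B₃.Op),
      regroup (A₁.tensor A₂) (B₁.tensor B₂) A₃ B₃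
        (kron (regroup A₁ B₁ A₂ B₂ (kron Z (kron a b))) (kron c d)) =
      tensorMap
        (relabel (A := A₁.tensor (A₂.tensor A₃)) (B := (A₁.tensor A₂).tensor A₃)
          (Equiv.prodAssoc A₁.Idx A₂.Idx A₃.Idx).symm)
        (relabel (A := B₁.tensor (B₂.tensor B₃)) (B := (B₁.tensor B₂).tensor B₃)
          (Equiv.prodAssoc B₁.Idx B₂.Idx B₃.Idx).symm)
        (regroup A₁ B₁ (A₂.tensor A₃) (B₂.tensor B₃) (kron Z (kron (kron a c) (kron b d)))) := by
    intro Z a b c d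
    rw [tensorMap_relabel]
    ext ⟨⟨⟨i, j⟩, k⟩, ⟨l, m⟩, n⟩ ⟨⟨⟨i', j'⟩, k'⟩, ⟨l', m'⟩, n'⟩
    change Z _ _ * (a _ _ * b _ _) * (c _ _ * d _ _) = Z _ _ * ((a _ _ * c _ _) * (b _ _ * d _ _))
    rw [mul_assoc, mul_mul_mul_comm]
    rfl
  have h : ∀ (A B C : QSys) (X : A.Op) (Y : B.Op) (Z : C.Op),
      relabel (A := (A.tensor B).tensor C) (B := A.tensor (B.tensor C))
        (Equiv.prodAssoc A.Idx B.Idx C.Idx) (kron (kron X Y) Z) = kron X (kron Y Z) := by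
    intro A B C X Y Z; ext ⟨a, b, c⟩ ⟨a', b', c'⟩
    exact mul_assoc _ _ _
  refine map_ext_matUnit fun p q => ?_
  simp only [matUnit_tensor]
  simp only [withMemory, LinearMap.comp_apply, regroup_kron, tensorMap_kron,
      LinearMap.id_apply, key, h]

/-- One-dimensional memories `U` and `V` can be removed again. -/
theorem eq_withMemory_trivial (U V : QSys) [Unique U.Idx] [Unique V.Idx]
    (N : Map (A₀.tensor B₀) (A₁.tensor B₁)) :
    tensorMap
        (relabel (A := A₁.tensor U) (B := A₁) (Equiv.prodUnique A₁.Idx U.Idx))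
        (relabel (A := B₁.tensor V) (B := B₁) (Equiv.prodUnique B₁.Idx V.Idx)) ∘ₗ
      withMemory U V N ∘ₗ
      tensorMap
        (relabel (A := A₀) (B := A₀.tensor U) (Equiv.prodUnique A₀.Idx U.Idx).symm)
        (relabel (A := B₀) (B := B₀.tensor V) (Equiv.prodUnique B₀.Idx V.Idx).symm) = N := by
  have h : ∀ (A U : QSys) [Unique U.Idx] (X : A.Op),
      relabel (A := A) (B := A.tensor U) (Equiv.prodUnique A.Idx U.Idx).symm X =
        kron X (1 : U.Op) := by
    intro A U _ X; ext ⟨a, b⟩ ⟨a', b'⟩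
    obtain rfl := Subsingleton.elim b b'
    simp [relabel_apply, kron_apply]
  refine map_ext_kron fun X Y => ?_
  simp only [LinearMap.comp_apply, tensorMap_kron, h, withMemory, regroup_kron,
    LinearMap.id_apply]
  rw [tensorMap_relabel]
  ext ⟨a, b⟩ ⟨a', b'⟩
  change N (kron X Y) (a, b) (a', b') * ((1 : U.Op) default default * (1 : V.Op) default default) = _
  simp only [Matrix.one_apply_eq, mul_one]

end withMemory

/-! ### Complete positivity and trace preservation -/

open scoped ComplexOrder

theorem isCP_relabel {A B : QSys} (e : A.Idx ≃ B.Idx) : IsCP (relabel e : Map A B) := by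
  intro R X hX
  have : tensorMap (LinearMap.id : Map R R) (relabel e : Map A B) X =
      X.submatrix ((Equiv.refl _).prodCongr e).symm ((Equiv.refl _).prodCongr e).symm := by
    have h := tensorMap_relabel (A := R) (A' := R) (Equiv.refl _) e
    exact LinearMap.congr_fun h X
  rw [this]
  exact hX.submatrix _

theorem IsCP.comp {A B C : QSys} {Φ : Map A B} {Ψ : Map B C} (hΨ : IsCP Ψ) (hΦ : IsCP Φ) :
    IsCP (Ψ ∘ₗ Φ) := by
  intro R X hX
  have := tensorMap_comp (LinearMap.id : Map R R) (LinearMap.id : Map R R) Φ Ψ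
  rw [LinearMap.id_comp] at this
  rw [← this]
  exact hΨ R _ (hΦ R X hX)

theorem isCP_id {A : QSys} : IsCP (LinearMap.id : Map A A) := by
  intro R X hX
  rwa [tensorMap_id]

theorem isCP_sum {A B : QSys} {J : Type} [Fintype J] {F : J → Map A B} (hF : ∀ j, IsCP (F j)) :
    IsCP (∑ j, F j) := by
  intro R X hX
  rw [tensorMap_sum_right, LinearMap.sum_apply]
  exact Matrix.posSemidef_sum _ fun j _ => hF j R X hX

theorem IsCP.add {A B : QSys} {Φ Ψ : Map A B} (hΦ : IsCP Φ) (hΨ : IsCP Ψ) : IsCP (Φ + Ψ) := by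
  intro R X hX
  have := (tensorMapₗ R R A B LinearMap.id).map_add Φ Ψ
  simp only [tensorMapₗ, LinearMap.mk₂_apply] at this
  rw [this]
  exact (hΦ R X hX).add (hΨ R X hX)

theorem IsCP.smul {A B : QSys} {Φ : Map A B} (hΦ : IsCP Φ) {c : ℝ} (hc : 0 ≤ c) :
    IsCP ((c : ℂ) • Φ) := by
  intro R X hX
  have := (tensorMapₗ R R A B LinearMap.id).map_smul (c : ℂ) Φ
  simp only [tensorMapₗ, LinearMap.mk₂_apply] at this
  rw [this]
  exact (hΦ R X hX).smul (by exact_mod_cast hc)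

theorem IsCP.id_tensorMap {S A B : QSys} {Φ : Map A B} (hΦ : IsCP Φ) :
    IsCP (tensorMap (LinearMap.id : Map S S) Φ) := by
  intro R X hX
  have h := LinearMap.congr_fun (relabel_comp_id_tensorMap (R := R) (S := S) Φ) X
  have h1 := hΦ (R.tensor S) (relabel (A := R.tensor (S.tensor A)) (B := (R.tensor S).tensor A)
        (Equiv.prodAssoc R.Idx S.Idx A.Idx).symm X) (hX.submatrix _)
  rw [LinearMap.comp_apply, LinearMap.comp_apply] at h
  rw [← h, relabel_apply] at h1
  exact (Matrix.posSemidef_submatrix_equiv _).1 h1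

theorem IsCP.tensorMap {A A' B B' : QSys} {Φ : Map A A'} {Ψ : Map B B'} (hΦ : IsCP Φ)
    (hΨ : IsCP Ψ) : IsCP (tensorMap Φ Ψ) := by
  have h : DynEnt.tensorMap Φ (LinearMap.id : Map B B) =
      relabel (A := B.tensor A') (B := A'.tensor B) (Equiv.prodComm B.Idx A'.Idx) ∘ₗ
        DynEnt.tensorMap (LinearMap.id : Map B B) Φ ∘ₗ
        relabel (A := A.tensor B) (B := B.tensor A) (Equiv.prodComm A.Idx B.Idx) := by
    rw [← relabel_swap_comp_tensorMap]
    exact congrArg (· ∘ₗ DynEnt.tensorMap Φ (LinearMap.id : Map B B))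
      (relabel_symm_comp (A := A'.tensor B) (B := B.tensor A') (Equiv.prodComm _ _)).symm
  have h2 := tensorMap_comp Φ (LinearMap.id : Map A' A') (LinearMap.id : Map B B) Ψ
  rw [LinearMap.id_comp, LinearMap.comp_id] at h2
  rw [← h2, h]
  exact hΨ.id_tensorMap.comp ((isCP_relabel _).comp (hΦ.id_tensorMap.comp (isCP_relabel _)))

theorem isTP_iff {A B : QSys} {Φ : Map A B} :
    IsTP Φ ↔ ∀ i j, (Φ (matUnit A i j)).trace = (matUnit A i j).trace := by
  refine ⟨fun h i j => h _, fun h X => ?_⟩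
  have : Matrix.traceLinearMap B.Idx ℂ ℂ ∘ₗ Φ = Matrix.traceLinearMap A.Idx ℂ ℂ :=
    Matrix.ext_linearMap ℂ fun i j => LinearMap.ext_ring (h i j)
  exact LinearMap.congr_fun this X

theorem trace_kron {A B : QSys} (X : A.Op) (Y : B.Op) :
    (kron X Y).trace = X.trace * Y.trace := Matrix.trace_kronecker X Y

theorem IsTP.tensorMap {A A' B B' : QSys} {Φ : Map A A'} {Ψ : Map B B'} (hΦ : IsTP Φ)
    (hΨ : IsTP Ψ) : IsTP (tensorMap Φ Ψ) :=
  isTP_iff.2 fun p q => by rw [matUnit_tensor, tensorMap_kron, trace_kron, trace_kron, hΦ, hΨ]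

theorem IsTP.comp {A B C : QSys} {Φ : Map A B} {Ψ : Map B C} (hΨ : IsTP Ψ) (hΦ : IsTP Φ) :
    IsTP (Ψ ∘ₗ Φ) := fun X => by rw [LinearMap.comp_apply, hΨ, hΦ]

theorem isTP_id {A : QSys} : IsTP (LinearMap.id : Map A A) := fun _ => rfl

theorem isTP_relabel {A B : QSys} (e : A.Idx ≃ B.Idx) : IsTP (relabel e : Map A B) := fun X => by
  rw [relabel_apply, Matrix.trace, Matrix.trace]
  exact Equiv.sum_comp e.symm fun i => X i i

theorem IsChannel.comp {A B C : QSys} {Φ : Map A B} {Ψ : Map B C} (hΨ : IsChannel Ψ)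
    (hΦ : IsChannel Φ) : IsChannel (Ψ ∘ₗ Φ) := ⟨hΨ.1.comp hΦ.1, hΨ.2.comp hΦ.2⟩

theorem IsChannel.tensorMap {A A' B B' : QSys} {Φ : Map A A'} {Ψ : Map B B'} (hΦ : IsChannel Φ)
    (hΨ : IsChannel Ψ) : IsChannel (tensorMap Φ Ψ) := ⟨hΦ.1.tensorMap hΨ.1, hΦ.2.tensorMap hΨ.2⟩

theorem isChannel_id {A : QSys} : IsChannel (LinearMap.id : Map A A) := ⟨isCP_id, isTP_id⟩

theorem isChannel_relabel {A B : QSys} (e : A.Idx ≃ B.Idx) : IsChannel (relabel e : Map A B) :=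
  ⟨isCP_relabel e, isTP_relabel e⟩

theorem convex_isChannel (A B : QSys) : Convex ℝ {Φ : Map A B | IsChannel Φ} := by
  rintro Φ ⟨h1, h2⟩ Ψ ⟨h3, h4⟩ a b ha hb hab
  refine ⟨(h1.smul ha).add (h3.smul hb), fun X => ?_⟩
  have hab' : (a : ℂ) + b = 1 := by exact_mod_cast hab
  change (a • Φ X + b • Ψ X).trace = _
  rw [Matrix.trace_add, Matrix.trace_smul, Matrix.trace_smul, h2, h4, Complex.real_smul,
    Complex.real_smul, ← add_mul, hab', one_mul]

/-- The completely positive map `X ↦ K X K†` with a single Kraus operator `K`. -/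
def kraus {A B : QSys} (K : Matrix B.Idx A.Idx ℂ) : Map A B where
  toFun X := K * X * K.conjTranspose
  map_add' X Y := by rw [Matrix.mul_add, Matrix.add_mul]
  map_smul' c X := by rw [Matrix.mul_smul, Matrix.smul_mul, RingHom.id_apply]

theorem kraus_apply {A B : QSys} (K : Matrix B.Idx A.Idx ℂ) (X : A.Op) :
    kraus K X = K * X * K.conjTranspose := rfl

theorem kraus_matUnit {A B : QSys} (K : Matrix B.Idx A.Idx ℂ) (i j : A.Idx) (a b : B.Idx) :
    kraus K (matUnit A i j) a b = K a i * star (K b j) := by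
  simp [kraus_apply, matUnit, Matrix.mul_apply, Matrix.single_apply, ite_and]

theorem isCP_kraus {A B : QSys} (K : Matrix B.Idx A.Idx ℂ) : IsCP (kraus K) := by
  intro R X hX
  have h : tensorMap (LinearMap.id : Map R R) (kraus K) =
      kraus (A := R.tensor A) (B := R.tensor B) ((1 : R.Op) ⊗ₖ K) :=
    map_ext_kron fun X Y => by
      rw [tensorMap_kron, LinearMap.id_apply, kraus_apply, kraus_apply]
      simp only [kron]
      rw [Matrix.conjTranspose_kronecker]
      erw [← Matrix.mul_kronecker_mul, ← Matrix.mul_kronecker_mul]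
      rw [Matrix.conjTranspose_one, Matrix.one_mul, Matrix.mul_one]
  rw [h, kraus_apply]
  exact hX.mul_mul_conjTranspose_same _

/-! ### The Choi matrix -/

theorem choi_apply {A B : QSys} (Φ : Map A B) (p q : A.Idx × B.Idx) :
    choi Φ p q = Φ (matUnit A p.1 q.1) p.2 q.2 := by
  obtain ⟨i, a⟩ := p
  obtain ⟨j, b⟩ := q
  simp only [choi, Matrix.sum_apply, Matrix.kroneckerMap_apply, Matrix.single_apply, ite_mul,
    one_mul, zero_mul, ite_and]
  simp [matUnit]

/-- The linear map `X ↦ ∑ᵢⱼ Xᵢⱼ Jᵢⱼ`, where `Jᵢⱼ` are the blocks of `J`; its Choi matrix is `J`. -/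
def ofChoi {A B : QSys} (J : (A.tensor B).Op) : Map A B where
  toFun X := Matrix.of fun a b => ∑ i, ∑ j, X i j * J (i, a) (j, b)
  map_add' X Y := by
    ext a b; simp only [Matrix.add_apply, add_mul, Finset.sum_add_distrib, Matrix.of_apply]
  map_smul' c X := by
    ext a b
    simp only [Matrix.smul_apply, smul_eq_mul, mul_assoc, Finset.mul_sum, RingHom.id_apply,
      Matrix.of_apply]

theorem ofChoi_apply {A B : QSys} (J : (A.tensor B).Op) (X : A.Op) (a b : B.Idx) :
    ofChoi J X a b = ∑ i, ∑ j, X i j * J (i, a) (j, b) := rfl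

theorem choi_ofChoi {A B : QSys} (J : (A.tensor B).Op) : choi (ofChoi J) = J := by
  ext p q
  rw [choi_apply, ofChoi_apply]
  simp [matUnit, Matrix.single_apply, ite_and]

theorem ofChoi_choi {A B : QSys} (Φ : Map A B) : ofChoi (choi Φ) = Φ :=
  map_ext_matUnit fun i j => by
    ext a b
    rw [ofChoi_apply]
    simp only [choi_apply]
    simp [matUnit, Matrix.single_apply, ite_and]

/-- The Choi isomorphism between linear maps and operators. -/
def choiEquiv (A B : QSys) : Map A B ≃ₗ[ℂ] (A.tensor B).Op where
  toFun := choi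
  map_add' Φ Ψ := by ext p q; simp only [choi_apply, LinearMap.add_apply, Matrix.add_apply]
  map_smul' c Φ := by
    ext p q; simp only [choi_apply, LinearMap.smul_apply, Matrix.smul_apply, RingHom.id_apply]
  invFun := ofChoi
  left_inv := ofChoi_choi
  right_inv := choi_ofChoi

theorem choiEquiv_apply {A B : QSys} (Φ : Map A B) : choiEquiv A B Φ = choi Φ := rfl

theorem choiEquiv_symm_apply {A B : QSys} (J : (A.tensor B).Op) :
    (choiEquiv A B).symm J = ofChoi J := rfl

open scoped MatrixOrder in
/-- Choi's theorem: a factorisation of a positive semidefinite Choi matrix yields Kraus operators. -/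
theorem isCP_iff_choi_posSemidef {A B : QSys} (Φ : Map A B) : IsCP Φ ↔ (choi Φ).PosSemidef := by
  constructor
  · intro h
    -- the Choi matrix is the image of the maximally entangled projector `|v⟩⟨v|`
    let v : A.Idx × A.Idx → ℂ := fun p => if p.1 = p.2 then 1 else 0
    have hv := h A _ (Matrix.posSemidef_vecMulVec_self_star v)
    convert hv
    ext p q
    simp only [tensorMap, LinearMap.coe_mk, AddHom.coe_mk, LinearMap.id_apply, choi,
      Matrix.sum_apply, Matrix.smul_apply, Matrix.vecMulVec_apply, v]
    simp
  · intro h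
    obtain ⟨M, hM⟩ := CStarAlgebra.nonneg_iff_eq_star_mul_self.1
      (Matrix.nonneg_iff_posSemidef.2 h)
    have : Φ = ∑ r, kraus (A := A) (B := B) (fun a i => star (M r (i, a))) := by
      apply (choiEquiv A B).injective
      rw [choiEquiv_apply, choiEquiv_apply]
      rw [hM]
      ext p q
      rw [choi_apply, LinearMap.sum_apply, Matrix.sum_apply]
      refine Finset.sum_congr rfl fun r _ => ((kraus_matUnit _ _ _ _ _).trans ?_).symm
      rw [star_star]
      rfl
    rw [this]
    exact isCP_sum fun r => isCP_kraus _

theorem IsTP.trace_choi {A B : QSys} {Φ : Map A B} (h : IsTP Φ) :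
    (choi Φ).trace = Fintype.card A.Idx := by
  rw [Matrix.trace, Fintype.sum_prod_type]
  have : ∀ i, ∑ a, choi Φ (i, a) (i, a) = 1 := fun i => by
    have := h (matUnit A i i)
    simp only [choi_apply]
    simpa [Matrix.trace, matUnit, Matrix.single_apply] using this
  simp [this]

/-! ### LOCC channels -/

section LOCC

variable {A B A' B' : QSys}

theorem IsInstrument.tensorMap_id {J : Type} [Fintype J] {F : J → Map A A'}
    (hF : IsInstrument F) (C : QSys) :
    IsInstrument fun j => tensorMap (F j) (LinearMap.id : Map C C) :=
  ⟨fun j => (hF.1 j).tensorMap isCP_id, by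
    rw [← tensorMap_sum_left]; exact hF.2.tensorMap isTP_id⟩

theorem IsInstrument.id_tensorMap {J : Type} [Fintype J] {F : J → Map A A'}
    (hF : IsInstrument F) (C : QSys) :
    IsInstrument fun j => tensorMap (LinearMap.id : Map C C) (F j) :=
  ⟨fun j => (hF.1 j).id_tensorMap, by
    rw [← tensorMap_sum_right]; exact isTP_id.tensorMap hF.2⟩

/-- Summing over the outcomes of an instrument, with a channel following each outcome, gives a
channel. -/
theorem isChannel_sum_comp {A B C : QSys} {J : Type} [Fintype J] {G : J → Map A B}
    {L : J → Map B C} (hG : IsInstrument G) (hL : ∀ j, IsChannel (L j)) :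
    IsChannel (∑ j, L j ∘ₗ G j) := by
  refine ⟨isCP_sum fun j => (hL j).1.comp (hG.1 j), fun X => ?_⟩
  rw [← hG.2 X, LinearMap.sum_apply, LinearMap.sum_apply, Matrix.trace_sum, Matrix.trace_sum]
  exact Finset.sum_congr rfl fun j _ => (hL j).2 _

theorem IsLOCC.isChannel {L : Map (A.tensor B) (A'.tensor B')} (h : IsLOCC L) : IsChannel L := by
  induction h with
  | product Φ Ψ hΦ hΨ => exact hΦ.tensorMap hΨ
  | alice F L hF _ ih => exact isChannel_sum_comp (hF.tensorMap_id _) ih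
  | bob F L hF _ ih => exact isChannel_sum_comp (hF.id_tensorMap _) ih

theorem isInstrument_of_isChannel {Φ : Map A A'} (h : IsChannel Φ) :
    IsInstrument fun _ : Unit => Φ :=
  ⟨fun _ => h.1, by simpa using h.2⟩

theorem IsLOCC.comp {C D : QSys} {L : Map (A.tensor B) (C.tensor D)}
    {M : Map (C.tensor D) (A'.tensor B')} (hM : IsLOCC M) (hL : IsLOCC L) :
    IsLOCC (M ∘ₗ L) := by
  induction hL with
  | product Φ Ψ hΦ hΨ =>
    have h1 := IsLOCC.bob _ _ (isInstrument_of_isChannel hΨ) fun _ => hM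
    have h2 := IsLOCC.alice _ _ (isInstrument_of_isChannel hΦ) fun _ => h1
    simp only [Finset.univ_unique, Finset.sum_const, Finset.card_singleton, one_smul] at h2
    rwa [LinearMap.comp_assoc, tensorMap_comp, LinearMap.comp_id, LinearMap.id_comp] at h2
  | alice F L hF _ ih =>
    rw [comp_sum]
    exact IsLOCC.alice F _ hF ih
  | bob F L hF _ ih =>
    rw [comp_sum]
    exact IsLOCC.bob F _ hF ih

theorem IsLOCC.withMemory {L : Map (A.tensor B) (A'.tensor B')} (hL : IsLOCC L) (C D : QSys) :
    IsLOCC (withMemory C D L) := by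
  induction hL with
  | product Φ Ψ hΦ hΨ =>
    rw [withMemory_tensorMap]
    exact IsLOCC.product _ _ (hΦ.tensorMap isChannel_id) (hΨ.tensorMap isChannel_id)
  | alice F L hF _ ih =>
    simp only [withMemory_sum, withMemory_comp, withMemory_tensorMap, DynEnt.tensorMap_id]
    exact IsLOCC.alice _ _ (hF.tensorMap_id C) ih
  | bob F L hF _ ih =>
    simp only [withMemory_sum, withMemory_comp, withMemory_tensorMap, DynEnt.tensorMap_id]
    exact IsLOCC.bob _ _ (hF.tensorMap_id D) ih

/-- Alice can draw a random outcome `j` with probability `p j` and announce it, so probabilistic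
mixtures of LOCC channels are LOCC. -/
theorem isLOCC_mix {J : Type} [Fintype J] {p : J → ℝ} (hp : ∀ j, 0 ≤ p j) (hp1 : ∑ j, p j = 1)
    {L : J → Map (A.tensor B) (A'.tensor B')} (hL : ∀ j, IsLOCC (L j)) :
    IsLOCC (∑ j, (p j : ℂ) • L j) := by
  have hF : IsInstrument fun j => ((p j : ℂ) • LinearMap.id : Map A A) := by
    refine ⟨fun j => isCP_id.smul (hp j), ?_⟩
    have : ∑ j, (p j : ℂ) = 1 := by exact_mod_cast hp1
    rw [← Finset.sum_smul, this, one_smul]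
    exact isTP_id
  have := IsLOCC.alice _ _ hF hL
  simpa only [tensorMap_smul_left, DynEnt.tensorMap_id, LinearMap.comp_smul,
    LinearMap.comp_id] using this

end LOCC

/-! ### LOCC superchannels -/

section Superchannel

variable {A₀ A₁ B₀ B₁ C₀ C₁ D₀ D₁ : QSys}

/-- The supermap `N ↦ post ∘ (N ⊗ id_{A₂ B₂}) ∘ pre`. -/
def comb (A₂ B₂ : QSys)
    (pre : Map (C₀.tensor D₀) ((A₀.tensor A₂).tensor (B₀.tensor B₂)))
    (post : Map ((A₁.tensor A₂).tensor (B₁.tensor B₂)) (C₁.tensor D₁)) :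
    SMap (A₀.tensor B₀) (A₁.tensor B₁) (C₀.tensor D₀) (C₁.tensor D₁) where
  toFun N := post ∘ₗ withMemory A₂ B₂ N ∘ₗ pre
  map_add' N N' := by rw [withMemory_add, LinearMap.add_comp, LinearMap.comp_add]
  map_smul' c N := by
    rw [withMemory_smul, LinearMap.smul_comp, LinearMap.comp_smul, RingHom.id_apply]

theorem isLOCCSuperchannel_iff
    {Θ : SMap (A₀.tensor B₀) (A₁.tensor B₁) (C₀.tensor D₀) (C₁.tensor D₁)} :
    IsLOCCSuperchannel Θ ↔ ∃ (A₂ B₂ : QSys)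
      (pre : Map (C₀.tensor D₀) ((A₀.tensor A₂).tensor (B₀.tensor B₂)))
      (post : Map ((A₁.tensor A₂).tensor (B₁.tensor B₂)) (C₁.tensor D₁)),
      IsLOCC pre ∧ IsLOCC post ∧ ∀ N, Θ N = post ∘ₗ withMemory A₂ B₂ N ∘ₗ pre :=
  Iff.rfl

theorem isLOCCSuperchannel_comb {A₂ B₂ : QSys}
    {pre : Map (C₀.tensor D₀) ((A₀.tensor A₂).tensor (B₀.tensor B₂))}
    {post : Map ((A₁.tensor A₂).tensor (B₁.tensor B₂)) (C₁.tensor D₁)}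
    (hpre : IsLOCC pre) (hpost : IsLOCC post) : IsLOCCSuperchannel (comb A₂ B₂ pre post) :=
  isLOCCSuperchannel_iff.2 ⟨A₂, B₂, pre, post, hpre, hpost, fun _ => rfl⟩

theorem isLOCC_relabel {A A' B B' : QSys} (e : A.Idx ≃ A'.Idx) (f : B.Idx ≃ B'.Idx) :
    IsLOCC (tensorMap (relabel e) (relabel f)) :=
  IsLOCC.product _ _ (isChannel_relabel e) (isChannel_relabel f)

/-- The composite keeps both pairs of memories, `A₂ ⊗ A₃` for Alice and `B₂ ⊗ B₃` for Bob. -/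
theorem IsLOCCSuperchannel.comp {K₀ K₁ L₀ L₁ : QSys}
    {Θ : SMap (A₀.tensor B₀) (A₁.tensor B₁) (C₀.tensor D₀) (C₁.tensor D₁)}
    {Ξ : SMap (C₀.tensor D₀) (C₁.tensor D₁) (K₀.tensor L₀) (K₁.tensor L₁)}
    (hΞ : IsLOCCSuperchannel Ξ) (hΘ : IsLOCCSuperchannel Θ) : IsLOCCSuperchannel (Ξ ∘ₗ Θ) := by
  obtain ⟨A₂, B₂, pre, post, hpre, hpost, hΘ⟩ := isLOCCSuperchannel_iff.1 hΘ
  obtain ⟨A₃, B₃, pre', post', hpre', hpost', hΞ⟩ := isLOCCSuperchannel_iff.1 hΞ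
  refine isLOCCSuperchannel_iff.2 ⟨A₂.tensor A₃, B₂.tensor B₃, _, _,
    (isLOCC_relabel (A := (A₀.tensor A₂).tensor A₃) (A' := A₀.tensor (A₂.tensor A₃))
      (B := (B₀.tensor B₂).tensor B₃) (B' := B₀.tensor (B₂.tensor B₃))
      (Equiv.prodAssoc _ _ _) (Equiv.prodAssoc _ _ _)).comp ((hpre.withMemory A₃ B₃).comp hpre'),
    hpost'.comp ((hpost.withMemory A₃ B₃).comp
      (isLOCC_relabel (A := A₁.tensor (A₂.tensor A₃)) (A' := (A₁.tensor A₂).tensor A₃)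
        (B := B₁.tensor (B₂.tensor B₃)) (B' := (B₁.tensor B₂).tensor B₃)
        (Equiv.prodAssoc _ _ _).symm (Equiv.prodAssoc _ _ _).symm)), fun N => ?_⟩
  rw [LinearMap.comp_apply, hΘ, hΞ, withMemory_comp, withMemory_comp, withMemory_withMemory]
  rfl

/-- A system of dimension one. -/
abbrev trivialSys : QSys := ⟨Unit⟩

variable (A₀ A₁ B₀ B₁) in
theorem isLOCCSuperchannel_id : IsLOCCSuperchannel
    (LinearMap.id : SMap (A₀.tensor B₀) (A₁.tensor B₁) (A₀.tensor B₀) (A₁.tensor B₁)) :=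
  isLOCCSuperchannel_iff.2 ⟨trivialSys, trivialSys, _, _, isLOCC_relabel _ _,
    isLOCC_relabel _ _, fun N => (eq_withMemory_trivial trivialSys trivialSys N).symm⟩

theorem IsCP.withMemory {N : Map (A₀.tensor B₀) (A₁.tensor B₁)} (hN : IsCP N) (A₂ B₂ : QSys) :
    IsCP (withMemory A₂ B₂ N) :=
  (isCP_relabel _).comp ((hN.tensorMap isCP_id).comp (isCP_relabel _))

theorem IsTP.withMemory {N : Map (A₀.tensor B₀) (A₁.tensor B₁)} (hN : IsTP N) (A₂ B₂ : QSys) :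
    IsTP (withMemory A₂ B₂ N) :=
  (isTP_relabel _).comp ((hN.tensorMap isTP_id).comp (isTP_relabel _))

theorem IsLOCCSuperchannel.isCP
    {Θ : SMap (A₀.tensor B₀) (A₁.tensor B₁) (C₀.tensor D₀) (C₁.tensor D₁)}
    (hΘ : IsLOCCSuperchannel Θ) {N : Map (A₀.tensor B₀) (A₁.tensor B₁)} (hN : IsCP N) :
    IsCP (Θ N) := by
  obtain ⟨A₂, B₂, pre, post, hpre, hpost, hΘ⟩ := isLOCCSuperchannel_iff.1 hΘ
  rw [hΘ]
  exact hpost.isChannel.1.comp ((hN.withMemory A₂ B₂).comp hpre.isChannel.1)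

theorem IsLOCCSuperchannel.isTP
    {Θ : SMap (A₀.tensor B₀) (A₁.tensor B₁) (C₀.tensor D₀) (C₁.tensor D₁)}
    (hΘ : IsLOCCSuperchannel Θ) {N : Map (A₀.tensor B₀) (A₁.tensor B₁)} (hN : IsTP N) :
    IsTP (Θ N) := by
  obtain ⟨A₂, B₂, pre, post, hpre, hpost, hΘ⟩ := isLOCCSuperchannel_iff.1 hΘ
  rw [hΘ]
  exact hpost.isChannel.2.comp ((hN.withMemory A₂ B₂).comp hpre.isChannel.2)

theorem IsLOCCSuperchannel.isChannel
    {Θ : SMap (A₀.tensor B₀) (A₁.tensor B₁) (C₀.tensor D₀) (C₁.tensor D₁)}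
    (hΘ : IsLOCCSuperchannel Θ) {N : Map (A₀.tensor B₀) (A₁.tensor B₁)} (hN : IsChannel N) :
    IsChannel (Θ N) := ⟨hΘ.isCP hN.1, hΘ.isTP hN.2⟩

/-- Discarding a system and preparing a basis state of another one is a channel. -/
theorem exists_isChannel (A B : QSys) : ∃ Φ : Map A B, IsChannel Φ := by
  obtain ⟨b⟩ := B.ne
  refine ⟨∑ i : A.Idx, kraus (A := A) (B := B) (Matrix.single b i 1),
    isCP_sum fun i => isCP_kraus _, isTP_iff.2 fun i j => ?_⟩
  rw [LinearMap.sum_apply, Matrix.trace_sum]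
  simp only [Matrix.trace, Matrix.diag, kraus_matUnit]
  simp [matUnit, Matrix.single_apply, ite_and, eq_comm]

variable (A₀ A₁ B₀ B₁ C₀ C₁ D₀ D₁) in
theorem exists_isLOCCSuperchannel :
    ∃ Θ : SMap (A₀.tensor B₀) (A₁.tensor B₁) (C₀.tensor D₀) (C₁.tensor D₁),
      IsLOCCSuperchannel Θ := by
  obtain ⟨Φ, hΦ⟩ := exists_isChannel C₀ (A₀.tensor trivialSys)
  obtain ⟨Ψ, hΨ⟩ := exists_isChannel D₀ (B₀.tensor trivialSys)
  obtain ⟨Φ', hΦ'⟩ := exists_isChannel (A₁.tensor trivialSys) C₁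
  obtain ⟨Ψ', hΨ'⟩ := exists_isChannel (B₁.tensor trivialSys) D₁
  exact ⟨_, isLOCCSuperchannel_comb (IsLOCC.product Φ Ψ hΦ hΨ) (IsLOCC.product Φ' Ψ' hΦ' hΨ')⟩

end Superchannel

/-! ### Mixtures of superchannels -/

/-- The direct sum of a family of systems. -/
abbrev sigmaSys {J : Type} [Fintype J] [DecidableEq J] [Nonempty J] (M : J → QSys) : QSys :=
  { Idx := Σ j, (M j).Idx
    ne := Nonempty.elim ‹Nonempty J› fun j => Nonempty.elim (M j).ne fun x => ⟨⟨j, x⟩⟩ }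

section Sigma

variable {J : Type} [Fintype J] [DecidableEq J] [Nonempty J] (M : J → QSys)

/-- The isometry that embeds the summand `M j` into the direct sum. -/
def sectorIsometry (j : J) : Matrix (sigmaSys M).Idx (M j).Idx ℂ :=
  fun s x => if s = ⟨j, x⟩ then 1 else 0

theorem sectorIsometry_conjTranspose_mul_self (j : J) :
    (sectorIsometry M j).conjTranspose * sectorIsometry M j = 1 := by
  ext x y
  simp [Matrix.mul_apply, sectorIsometry, Matrix.one_apply, eq_comm]

theorem sectorIsometry_conjTranspose_mul_of_ne {j k : J} (h : j ≠ k) :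
    (sectorIsometry M j).conjTranspose * sectorIsometry M k = 0 := by
  ext x y
  have : ∀ s : (sigmaSys M).Idx, ¬ (s = ⟨j, x⟩ ∧ s = ⟨k, y⟩) := by
    rintro s ⟨rfl, h'⟩
    exact h (congrArg Sigma.fst h')
  rw [Matrix.mul_apply]
  refine Finset.sum_eq_zero fun s _ => ?_
  have := this s
  simp only [Matrix.conjTranspose_apply, sectorIsometry]
  by_cases h1 : s = ⟨j, x⟩ <;> by_cases h2 : s = ⟨k, y⟩ <;> simp_all

/-- The embedding channel of a summand into the direct sum. -/
def embed (j : J) : Map (M j) (sigmaSys M) := kraus (sectorIsometry M j)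

/-- The unnormalised projection of the direct sum onto a summand. -/
def restrict (j : J) : Map (sigmaSys M) (M j) := kraus (sectorIsometry M j).conjTranspose

theorem restrict_apply (j : J) (X : (sigmaSys M).Op) (x y : (M j).Idx) :
    restrict M j X x y = X ⟨j, x⟩ ⟨j, y⟩ := by
  simp [restrict, kraus_apply, Matrix.mul_apply, sectorIsometry]

theorem restrict_comp_embed (j : J) : restrict M j ∘ₗ embed M j = LinearMap.id := by
  ext1 X
  rw [LinearMap.comp_apply, restrict, embed, kraus_apply, kraus_apply,
    Matrix.conjTranspose_conjTranspose]
  have h := sectorIsometry_conjTranspose_mul_self M j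
  calc _ = ((sectorIsometry M j).conjTranspose * sectorIsometry M j) * X *
        ((sectorIsometry M j).conjTranspose * sectorIsometry M j) := by
        simp only [Matrix.mul_assoc]
    _ = _ := by rw [h, Matrix.one_mul, Matrix.mul_one]; rfl

theorem restrict_comp_embed_of_ne {j k : J} (h : j ≠ k) : restrict M j ∘ₗ embed M k = 0 := by
  ext1 X
  rw [LinearMap.comp_apply, restrict, embed, kraus_apply, kraus_apply, ← Matrix.mul_assoc,
    ← Matrix.mul_assoc, sectorIsometry_conjTranspose_mul_of_ne M h, Matrix.zero_mul,
    Matrix.zero_mul, Matrix.zero_mul]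
  rfl

theorem trace_embed (j : J) (X : (M j).Op) : (embed M j X).trace = X.trace := by
  rw [embed, kraus_apply, Matrix.trace_mul_comm, ← Matrix.mul_assoc,
    sectorIsometry_conjTranspose_mul_self, Matrix.one_mul]

theorem isChannel_embed (j : J) : IsChannel (embed M j) :=
  ⟨isCP_kraus _, trace_embed M j⟩

theorem sum_trace_restrict (X : (sigmaSys M).Op) : ∑ j, (restrict M j X).trace = X.trace := by
  simp only [Matrix.trace, Matrix.diag, restrict_apply]
  exact (Fintype.sum_sigma' fun j x => X ⟨j, x⟩ ⟨j, x⟩).symm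

/-- The projective measurement of the summand. -/
theorem isInstrument_embed_comp_restrict :
    IsInstrument fun j => embed M j ∘ₗ restrict M j :=
  ⟨fun j => (isCP_kraus _).comp (isCP_kraus _), fun X => by
    rw [LinearMap.sum_apply, Matrix.trace_sum, ← sum_trace_restrict M X]
    exact Finset.sum_congr rfl fun j _ => trace_embed M j _⟩

/-- A channel from the direct sum to a summand that undoes the embedding: states of the other
summands are discarded and replaced by a fixed one. -/
theorem exists_isChannel_comp_embed (j : J) :
    ∃ c : Map (sigmaSys M) (M j), IsChannel c ∧ c ∘ₗ embed M j = LinearMap.id := by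
  choose Φ hΦ using fun k => exists_isChannel (M k) (M j)
  let Ψ : ∀ k, Map (M k) (M j) := Function.update Φ j LinearMap.id
  have hΨ : ∀ k, IsChannel (Ψ k) := fun k => by
    by_cases h : k = j
    · subst h; simp only [Ψ, Function.update_self]; exact isChannel_id
    · simp only [Ψ, Function.update_of_ne h]; exact hΦ k
  refine ⟨∑ k, Ψ k ∘ₗ restrict M k,
    ⟨isCP_sum fun k => (hΨ k).1.comp (isCP_kraus _), fun X => ?_⟩, ?_⟩
  · simp only [LinearMap.sum_apply, Matrix.trace_sum, LinearMap.comp_apply, (hΨ _).2 _,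
      sum_trace_restrict]
  · rw [sum_comp, Finset.sum_eq_single j]
    · rw [LinearMap.comp_assoc, restrict_comp_embed, LinearMap.comp_id]
      simp only [Ψ, Function.update_self]
    · intro k _ hk
      rw [LinearMap.comp_assoc, restrict_comp_embed_of_ne M hk, LinearMap.comp_zero]
    · simp

variable {A₀ A₁ B₀ B₁ C₀ C₁ D₀ D₁ : QSys}

/-- A mixture of LOCC superchannels is an LOCC superchannel. The branch `j` is drawn at random
before the preprocessing and shared; both parties store it, as the summand in which their
memories live, and before the postprocessing Alice reads it off and announces it. -/
theorem isLOCCSuperchannel_mix {p : J → ℝ} (hp : ∀ j, 0 ≤ p j) (hp1 : ∑ j, p j = 1)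
    {Θ : J → SMap (A₀.tensor B₀) (A₁.tensor B₁) (C₀.tensor D₀) (C₁.tensor D₁)}
    (hΘ : ∀ j, IsLOCCSuperchannel (Θ j)) : IsLOCCSuperchannel (∑ j, (p j : ℂ) • Θ j) := by
  choose A₂ B₂ pre post hpre hpost hΘ using fun j => isLOCCSuperchannel_iff.1 (hΘ j)
  choose cA hcA hcA' using exists_isChannel_comp_embed A₂
  choose cB hcB hcB' using exists_isChannel_comp_embed B₂
  refine isLOCCSuperchannel_iff.2 ⟨sigmaSys A₂, sigmaSys B₂,
    ∑ j, (p j : ℂ) • (tensorMap (tensorMap LinearMap.id (embed A₂ j))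
      (tensorMap LinearMap.id (embed B₂ j)) ∘ₗ pre j),
    ∑ j, (post j ∘ₗ tensorMap (tensorMap LinearMap.id (cA j)) (tensorMap LinearMap.id (cB j))) ∘ₗ
      tensorMap (tensorMap LinearMap.id (embed A₂ j ∘ₗ restrict A₂ j)) LinearMap.id,
    isLOCC_mix hp hp1 fun j => (IsLOCC.product _ _ (isChannel_id.tensorMap (isChannel_embed _ _))
      (isChannel_id.tensorMap (isChannel_embed _ _))).comp (hpre j),
    IsLOCC.alice _ _ ((isInstrument_embed_comp_restrict A₂).id_tensorMap A₁) fun j =>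
      (hpost j).comp (IsLOCC.product _ _ (isChannel_id.tensorMap (hcA j))
        (isChannel_id.tensorMap (hcB j))), fun N => ?_⟩
  -- the branch announced after the call to `N` is the one drawn before it
  have key : ∀ j k,
      ((post j ∘ₗ tensorMap (tensorMap LinearMap.id (cA j)) (tensorMap LinearMap.id (cB j))) ∘ₗ
        tensorMap (tensorMap LinearMap.id (embed A₂ j ∘ₗ restrict A₂ j)) LinearMap.id) ∘ₗ
      withMemory (sigmaSys A₂) (sigmaSys B₂) N ∘ₗ
      (tensorMap (tensorMap LinearMap.id (embed A₂ k))
        (tensorMap LinearMap.id (embed B₂ k)) ∘ₗ pre k) = if j = k then Θ j N else 0 := by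
    intro j k
    calc _ = post j ∘ₗ (tensorMap (tensorMap LinearMap.id (cA j))
            (tensorMap LinearMap.id (cB j)) ∘ₗ
          (tensorMap (tensorMap LinearMap.id (embed A₂ j ∘ₗ restrict A₂ j)) LinearMap.id) ∘ₗ
          (withMemory (sigmaSys A₂) (sigmaSys B₂) N ∘ₗ
            tensorMap (tensorMap LinearMap.id (embed A₂ k))
              (tensorMap LinearMap.id (embed B₂ k)))) ∘ₗ pre k := rfl
      _ = post j ∘ₗ ((tensorMap (tensorMap LinearMap.id (cA j))
            (tensorMap LinearMap.id (cB j)) ∘ₗ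
          (tensorMap (tensorMap LinearMap.id (embed A₂ j ∘ₗ restrict A₂ j)) LinearMap.id) ∘ₗ
            tensorMap (tensorMap LinearMap.id (embed A₂ k))
              (tensorMap LinearMap.id (embed B₂ k))) ∘ₗ withMemory (A₂ k) (B₂ k) N) ∘ₗ pre k := by
        rw [withMemory_comp_memory]; rfl
      _ = _ := by
        rw [tensorMap_comp, tensorMap_comp, tensorMap_comp, LinearMap.id_comp, LinearMap.id_comp,
          tensorMap_comp, LinearMap.comp_assoc (embed A₂ k)]
        split_ifs with h
        · subst h
          simp only [restrict_comp_embed, LinearMap.comp_id, hcA', tensorMap_comp, hcB',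
            tensorMap_id, LinearMap.id_comp, hΘ]
        · rw [restrict_comp_embed_of_ne A₂ h, LinearMap.comp_zero, LinearMap.comp_zero,
            tensorMap_zero_right, tensorMap_zero_left, LinearMap.zero_comp, LinearMap.zero_comp,
            LinearMap.comp_zero]
  simp only [comp_sum, sum_comp, LinearMap.comp_smul, key,
    Finset.sum_ite_eq', Finset.mem_univ, if_true, LinearMap.sum_apply, LinearMap.smul_apply]

end Sigma

variable (A₀ A₁ B₀ B₁ C₀ C₁ D₀ D₁ : QSys) in
theorem convex_isLOCCSuperchannel : Convex ℝ
    {Θ : SMap (A₀.tensor B₀) (A₁.tensor B₁) (C₀.tensor D₀) (C₁.tensor D₁) |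
      IsLOCCSuperchannel Θ} := by
  intro Θ hΘ Ξ hΞ a b ha hb hab
  have h := isLOCCSuperchannel_mix (J := Bool) (p := fun j => cond j a b)
    (Θ := fun j => cond j Θ Ξ) (by simp [ha, hb]) (by simpa using hab)
    (by rintro (_ | _); exacts [hΞ, hΘ])
  rw [Fintype.sum_bool] at h
  exact h

/-! ### Order bounds on Choi matrices -/

section Bounds

open scoped ComplexOrder

open scoped MatrixOrder in
/-- With `X = M† M`, this is `|Mₖᵢ| |Mₖⱼ| ≤ ∑ₗ |Mₖₗ|²` summed over `k`. -/
theorem norm_apply_le_trace {n : Type} [Fintype n] [DecidableEq n] {X : Matrix n n ℂ}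
    (hX : X.PosSemidef) (i j : n) : ‖X i j‖ ≤ X.trace.re := by
  obtain ⟨M, rfl⟩ := CStarAlgebra.nonneg_iff_eq_star_mul_self.1
    (Matrix.nonneg_iff_posSemidef.2 hX)
  have htr : (star M * M).trace.re = ∑ k, ∑ l, ‖M k l‖ ^ 2 := by
    rw [Matrix.trace, Complex.re_sum, Finset.sum_comm]
    refine Finset.sum_congr rfl fun l _ => ?_
    rw [Matrix.diag_apply, Matrix.mul_apply, Complex.re_sum]
    refine Finset.sum_congr rfl fun k _ => ?_
    rw [Matrix.star_apply, ← Complex.normSq_eq_norm_sq, Complex.star_def,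
      ← Complex.normSq_eq_conj_mul_self, Complex.ofReal_re]
  rw [htr, Matrix.mul_apply]
  refine (norm_sum_le _ _).trans (Finset.sum_le_sum fun k _ => ?_)
  rw [norm_mul, Matrix.star_apply, norm_star]
  have h : ∀ l, ‖M k l‖ ^ 2 ≤ ∑ l, ‖M k l‖ ^ 2 := fun l =>
    Finset.single_le_sum (f := fun l => ‖M k l‖ ^ 2) (fun _ _ => sq_nonneg _) (Finset.mem_univ l)
  nlinarith [h i, h j, sq_nonneg (‖M k i‖ - ‖M k j‖)]

open scoped MatrixOrder Matrix.Norms.L2Operator in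
theorem exists_posSemidef_smul_one_sub {n : Type} [Fintype n] [DecidableEq n] {H : Matrix n n ℂ}
    (hH : H.IsHermitian) : ∃ c : ℝ, 0 < c ∧ ((c : ℂ) • (1 : Matrix n n ℂ) - H).PosSemidef := by
  have h1 : H ≤ algebraMap ℝ _ ‖H‖ := IsSelfAdjoint.le_algebraMap_norm_self hH
  refine ⟨‖H‖ + 1, by positivity, ?_⟩
  have h2 := (Matrix.le_iff.1 h1).add Matrix.PosSemidef.one
  have e : ((‖H‖ + 1 : ℝ) : ℂ) • (1 : Matrix n n ℂ) - H = algebraMap ℝ _ ‖H‖ - H + 1 := by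
    rw [Algebra.algebraMap_eq_smul_one, Complex.ofReal_add, add_smul, Complex.ofReal_one,
      one_smul, sub_add_eq_add_sub]
    rfl
  rw [e]
  exact h2

/-- Trace preservation says that the partial trace of the Choi matrix over the output is `1`. -/
theorem isTP_iff_choi {A B : QSys} {Φ : Map A B} :
    IsTP Φ ↔ ∀ i j, ∑ a, choi Φ (i, a) (j, a) = if i = j then 1 else 0 := by
  rw [isTP_iff]
  refine forall₂_congr fun i j => ?_
  have : (matUnit A i j).trace = if i = j then 1 else 0 := by
    split_ifs with h
    · subst h; simp [matUnit]
    · simp [matUnit, Matrix.trace_single_eq_of_ne _ _ _ h]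
  rw [this]
  simp only [choi_apply]
  rfl

/-- The completely depolarizing channel, whose Choi matrix is a multiple of the identity. -/
theorem exists_isChannel_choi_eq (A B : QSys) :
    ∃ D : Map A B, IsChannel D ∧ (Fintype.card B.Idx : ℂ) • choi D = 1 := by
  have hd : (Fintype.card B.Idx : ℂ) ≠ 0 := Nat.cast_ne_zero.2 Fintype.card_ne_zero
  refine ⟨ofChoi ((Fintype.card B.Idx : ℂ)⁻¹ • 1), ⟨?_, ?_⟩, ?_⟩
  · rw [isCP_iff_choi_posSemidef, choi_ofChoi]
    exact Matrix.PosSemidef.one.smul (by positivity)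
  · rw [isTP_iff_choi]
    intro i j
    rw [choi_ofChoi]
    by_cases h : i = j
    · subst h; simp [hd]
    · simp [h]
  · rw [choi_ofChoi, smul_smul, mul_inv_cancel₀ hd, one_smul]

variable {A₀ A₁ B₀ B₁ C₀ C₁ D₀ D₁ : QSys}

/-- The LOCC superchannels are uniformly bounded on each completely positive map `Φ`: if
`c • D - Φ` is completely positive for a channel `D`, then `Tr J^{Θ[Φ]} ≤ c Tr J^{Θ[D]}`, which
does not depend on `Θ`. -/
theorem exists_bound_of_isCP {Φ : Map (A₀.tensor B₀) (A₁.tensor B₁)} (hΦ : IsCP Φ) :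
    ∃ C : ℝ, ∀ Θ : SMap (A₀.tensor B₀) (A₁.tensor B₁) (C₀.tensor D₀) (C₁.tensor D₁),
      IsLOCCSuperchannel Θ → ∀ p q, ‖choi (Θ Φ) p q‖ ≤ C := by
  obtain ⟨D, hD, hD1⟩ := exists_isChannel_choi_eq (A₀.tensor B₀) (A₁.tensor B₁)
  obtain ⟨c, hc, hcJ⟩ := exists_posSemidef_smul_one_sub
    ((isCP_iff_choi_posSemidef Φ).1 hΦ).isHermitian
  set k : ℂ := (c : ℂ) * (Fintype.card (A₁.tensor B₁).Idx : ℂ) with hk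
  have hcp : IsCP (k • D - Φ) := by
    rw [isCP_iff_choi_posSemidef, ← choiEquiv_apply, map_sub, map_smul, choiEquiv_apply,
      choiEquiv_apply, hk, mul_smul, hD1]
    exact hcJ
  refine ⟨(k * Fintype.card (C₀.tensor D₀).Idx).re, fun Θ hΘ p q => ?_⟩
  refine (norm_apply_le_trace ((isCP_iff_choi_posSemidef _).1 (hΘ.isCP hΦ)) p q).trans ?_
  have h := (isCP_iff_choi_posSemidef _).1 (hΘ.isCP hcp)
  have h' := (Complex.le_def.1 h.trace_nonneg).1
  rw [map_sub, map_smul, ← choiEquiv_apply, map_sub, map_smul, choiEquiv_apply, choiEquiv_apply,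
    Matrix.trace_sub, Matrix.trace_smul, (hΘ.isTP hD.2).trace_choi, Complex.sub_re,
    Complex.zero_re, smul_eq_mul] at h'
  linarith

open scoped MatrixOrder in
/-- The LOCC superchannels are uniformly bounded on every linear map, as completely positive maps
span. -/
theorem exists_bound (Φ : Map (A₀.tensor B₀) (A₁.tensor B₁)) :
    ∃ C : ℝ, ∀ Θ : SMap (A₀.tensor B₀) (A₁.tensor B₁) (C₀.tensor D₀) (C₁.tensor D₁),
      IsLOCCSuperchannel Θ → ∀ p q, ‖choi (Θ Φ) p q‖ ≤ C := by
  have hspan : choi Φ ∈ Submodule.span ℂ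
      {X : ((A₀.tensor B₀).tensor (A₁.tensor B₁)).Op | 0 ≤ X} := by
    rw [CStarAlgebra.span_nonneg]; trivial
  rw [← ofChoi_choi Φ]
  generalize choi Φ = J at hspan
  induction hspan using Submodule.span_induction with
  | mem X hX =>
    refine exists_bound_of_isCP ((isCP_iff_choi_posSemidef _).2 ?_)
    rw [choi_ofChoi]
    exact Matrix.nonneg_iff_posSemidef.1 hX
  | zero =>
    refine ⟨0, fun Θ _ p q => ?_⟩
    rw [← choiEquiv_symm_apply, ← choiEquiv_apply, map_zero, map_zero, map_zero,
      Matrix.zero_apply, norm_zero]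
  | add X Y _ _ hX hY =>
    obtain ⟨a, ha⟩ := hX
    obtain ⟨b, hb⟩ := hY
    refine ⟨a + b, fun Θ hΘ p q => ?_⟩
    rw [← choiEquiv_symm_apply, ← choiEquiv_apply, map_add, map_add, map_add, Matrix.add_apply]
    exact (norm_add_le _ _).trans (add_le_add (ha Θ hΘ p q) (hb Θ hΘ p q))
  | smul c X _ hX =>
    obtain ⟨a, ha⟩ := hX
    refine ⟨‖c‖ * a, fun Θ hΘ p q => ?_⟩
    rw [← choiEquiv_symm_apply, ← choiEquiv_apply, map_smul, map_smul, map_smul,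
      Matrix.smul_apply, norm_smul]
    exact mul_le_mul_of_nonneg_left (ha Θ hΘ p q) (norm_nonneg c)

end Bounds

/-! ### The compact set of limits of LOCC superchannels -/

instance firstCountableTopology_matrix (m n : Type) [Fintype m] [Fintype n] :
    FirstCountableTopology (Matrix m n ℂ) :=
  inferInstanceAs (FirstCountableTopology (m → n → ℂ))

instance locallyConvexSpace_matrix (m n : Type) : LocallyConvexSpace ℝ (Matrix m n ℂ) :=
  inferInstanceAs (LocallyConvexSpace ℝ (m → n → ℂ))

section Compact

/-- The Choi isomorphism for supermaps: supermaps are linear maps between the operator spaces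
that contain the Choi matrices of their arguments and values. -/
def superChoi (A A' B B' : QSys) :
    SMap A A' B B' ≃ₗ[ℂ] ((A.tensor A').tensor (B.tensor B')).Op :=
  (LinearEquiv.arrowCongr (choiEquiv A A') (choiEquiv B B')).trans
    (choiEquiv (A.tensor A') (B.tensor B'))

theorem superChoi_apply {A A' B B' : QSys} (Θ : SMap A A' B B')
    (p q : (A.tensor A').Idx × (B.tensor B').Idx) :
    superChoi A A' B B' Θ p q = choi (Θ (ofChoi (matUnit _ p.1 q.1))) p.2 q.2 := by
  change choi _ p q = _
  rw [choi_apply]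
  rfl

/-- Evaluation of a supermap at `N`, in terms of Choi matrices. -/
def superEval {A A' : QSys} (B B' : QSys) (N : Map A A') :
    ((A.tensor A').tensor (B.tensor B')).Op →ₗ[ℂ] (B.tensor B').Op :=
  (choiEquiv B B').toLinearMap ∘ₗ LinearMap.applyₗ N ∘ₗ (superChoi A A' B B').symm.toLinearMap

theorem superEval_apply {A A' B B' : QSys} (N : Map A A')
    (T : ((A.tensor A').tensor (B.tensor B')).Op) :
    superEval B B' N T = choi ((superChoi A A' B B').symm T N) := rfl

theorem continuous_superEval {A A' B B' : QSys} (N : Map A A') :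
    Continuous (superEval B B' N) := LinearMap.continuous_of_finiteDimensional _

theorem superEval_superChoi {A A' B B' : QSys} (N : Map A A') (Θ : SMap A A' B B') :
    superEval B B' N (superChoi A A' B B' Θ) = choi (Θ N) := by
  rw [superEval_apply, LinearEquiv.symm_apply_apply]

variable (A₀ A₁ B₀ B₁ C₀ C₁ D₀ D₁ : QSys)

/-- The topological closure of the set of LOCC superchannels, in terms of Choi matrices. -/
def loccClosure :
    Set (((A₀.tensor B₀).tensor (A₁.tensor B₁)).tensor
      ((C₀.tensor D₀).tensor (C₁.tensor D₁))).Op :=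
  closure (superChoi _ _ _ _ ''
    {Θ : SMap (A₀.tensor B₀) (A₁.tensor B₁) (C₀.tensor D₀) (C₁.tensor D₁) |
      IsLOCCSuperchannel Θ})

theorem isCompact_loccClosure : IsCompact (loccClosure A₀ A₁ B₀ B₁ C₀ C₁ D₀ D₁) := by
  choose C hC using fun Φ : Map (A₀.tensor B₀) (A₁.tensor B₁) =>
    exists_bound (C₀ := C₀) (C₁ := C₁) (D₀ := D₀) (D₁ := D₁) Φ
  have hK := isCompact_univ_pi fun p : (((A₀.tensor B₀).tensor (A₁.tensor B₁)).tensor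
      ((C₀.tensor D₀).tensor (C₁.tensor D₁))).Idx =>
    isCompact_univ_pi fun q : (((A₀.tensor B₀).tensor (A₁.tensor B₁)).tensor
      ((C₀.tensor D₀).tensor (C₁.tensor D₁))).Idx =>
    isCompact_closedBall (0 : ℂ) (C (ofChoi (matUnit _ p.1 q.1)))
  refine hK.of_isClosed_subset isClosed_closure (closure_minimal ?_ hK.isClosed)
  rintro _ ⟨Θ, hΘ, rfl⟩ p - q -
  rw [mem_closedBall_zero_iff, superChoi_apply]
  exact hC _ Θ hΘ _ _

theorem convex_loccClosure : Convex ℝ (loccClosure A₀ A₁ B₀ B₁ C₀ C₁ D₀ D₁) :=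
  ((convex_isLOCCSuperchannel A₀ A₁ B₀ B₁ C₀ C₁ D₀ D₁).linear_image
    ((superChoi (A₀.tensor B₀) (A₁.tensor B₁) (C₀.tensor D₀)
      (C₁.tensor D₁)).toLinearMap.restrictScalars ℝ)).closure

variable {A₀ A₁ B₀ B₁ C₀ C₁ D₀ D₁}

theorem isClosureLOCCSuperchannel_of_mem
    {T : (((A₀.tensor B₀).tensor (A₁.tensor B₁)).tensor
      ((C₀.tensor D₀).tensor (C₁.tensor D₁))).Op}
    (hT : T ∈ loccClosure A₀ A₁ B₀ B₁ C₀ C₁ D₀ D₁) :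
    IsClosureLOCCSuperchannel ((superChoi _ _ _ _).symm T) := by
  obtain ⟨u, hu, hlim⟩ := mem_closure_iff_seq_limit.1 hT
  choose Ξ hΞ hΞu using hu
  refine ⟨Ξ, hΞ, fun N X => ?_⟩
  have hcont : Continuous
      (LinearMap.applyₗ X ∘ₗ LinearMap.applyₗ N ∘ₗ (superChoi (A₀.tensor B₀) (A₁.tensor B₁)
        (C₀.tensor D₀) (C₁.tensor D₁)).symm.toLinearMap : _ →ₗ[ℂ] (C₁.tensor D₁).Op) :=
    LinearMap.continuous_of_finiteDimensional _
  have := (hcont.tendsto T).comp hlim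
  refine this.congr fun n => ?_
  rw [Function.comp_apply, ← hΞu n]
  simp only [LinearMap.comp_apply, LinearEquiv.coe_coe, LinearEquiv.symm_apply_apply]
  rfl

theorem loccConvertible_of_mem {N : Map (A₀.tensor B₀) (A₁.tensor B₁)}
    {M : Map (C₀.tensor D₀) (C₁.tensor D₁)}
    (h : choi M ∈ superEval _ _ N '' loccClosure A₀ A₁ B₀ B₁ C₀ C₁ D₀ D₁) :
    LOCCConvertible N M := by
  obtain ⟨T, hT, hTM⟩ := h
  exact ⟨_, isClosureLOCCSuperchannel_of_mem hT, (choiEquiv _ _).injective hTM⟩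

end Compact

/-! ### Separating functionals as channels -/

/-- Every real-linear functional on complex matrices is `X ↦ Re Tr[W X]` for some `W`. -/
theorem exists_eq_re_trace_mul {n : Type} [Fintype n] [DecidableEq n]
    (f : Matrix n n ℂ →ₗ[ℝ] ℝ) : ∃ W : Matrix n n ℂ, ∀ X, f X = (W * X).trace.re := by
  let W : Matrix n n ℂ := Matrix.of fun j i =>
    (f (Matrix.single i j 1) - Complex.I * f (Matrix.single i j Complex.I) : ℂ)
  have hf : ∀ (i j : n) (z : ℂ), f (Matrix.single i j z) = (W j i * z).re := by
    intro i j z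
    have hz : Matrix.single i j z =
        z.re • Matrix.single i j (1 : ℂ) + z.im • Matrix.single i j Complex.I := by
      rw [Matrix.smul_single, Matrix.smul_single, ← Matrix.single_add, Complex.real_smul,
        Complex.real_smul, mul_one, Complex.re_add_im]
    rw [hz, map_add, map_smul, map_smul]
    simp [W, mul_comm]
  refine ⟨W, fun X => ?_⟩
  rw [Matrix.trace_mul_comm, Matrix.trace]
  conv_lhs => rw [Matrix.matrix_eq_sum_single X]
  simp only [map_sum, hf, Matrix.diag_apply, Matrix.mul_apply, Complex.re_sum, mul_comm]

open scoped ComplexOrder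

theorem re_trace_conjTranspose_mul {n : Type} [Fintype n] (W : Matrix n n ℂ) {X : Matrix n n ℂ}
    (hX : X.IsHermitian) : (W.conjTranspose * X).trace.re = (W * X).trace.re := by
  have : W.conjTranspose * X = (X * W).conjTranspose := by
    rw [Matrix.conjTranspose_mul, hX.eq]
  rw [this, Matrix.trace_conjTranspose, Complex.star_def, Complex.conj_re, Matrix.trace_mul_comm]

/-- For Hermitian `H`, the functional `Tr[H J^Φ]` of a channel `Φ` agrees up to a positive factor
and an additive constant with `Tr[J^P J^Φ]` for some channel `P`. Indeed, subtracting
`Tr_B H ⊗ 1 / d_B` from `H` shifts the functional by a constant, as `Φ` preserves the trace; the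
result `H'` has vanishing partial trace, and a suitable multiple of `c • 1 + H'` is the Choi matrix
of a channel for `c` large. -/
theorem exists_isChannel_trace_mul_choi {A B : QSys} {H : (A.tensor B).Op}
    (hH : H.IsHermitian) : ∃ P : Map A B, IsChannel P ∧ ∃ ε : ℝ, 0 < ε ∧ ∃ c : ℝ,
      ∀ Φ : Map A B, IsTP Φ →
        (choi P * choi Φ).trace.re = ε * (H * choi Φ).trace.re + c := by
  have hd : (Fintype.card B.Idx : ℂ) ≠ 0 := Nat.cast_ne_zero.2 Fintype.card_ne_zero
  set d : ℂ := (Fintype.card B.Idx : ℂ) with hd_def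
  let R : A.Op := Matrix.of fun i j => ∑ a, H (i, a) (j, a)
  have hR : R.IsHermitian := by
    ext i j
    simp only [Matrix.conjTranspose_apply, R, Matrix.of_apply, star_sum]
    exact Finset.sum_congr rfl fun a _ => hH.apply _ _
  let H' : (A.tensor B).Op := H - d⁻¹ • kron R (1 : B.Op)
  have hH' : (-H').IsHermitian := by
    have h1 : (kron R (1 : B.Op)).IsHermitian := by
      ext p q
      rw [Matrix.conjTranspose_apply, kron_apply, kron_apply, star_mul', hR.apply]
      congr 1
      exact (Matrix.isHermitian_one (n := B.Idx) (α := ℂ)).apply _ _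
    have h2 : (d⁻¹ • kron R (1 : B.Op)).IsHermitian := by
      rw [Matrix.IsHermitian, Matrix.conjTranspose_smul, h1.eq]
      simp [d]
    exact (hH.sub h2).neg
  obtain ⟨c, hc, hpos⟩ := exists_posSemidef_smul_one_sub hH'
  have hc' : (c : ℂ) ≠ 0 := by exact_mod_cast hc.ne'
  rw [sub_neg_eq_add] at hpos
  let ε : ℝ := ((Fintype.card B.Idx : ℝ) * c)⁻¹
  have hcard : (0 : ℝ) < Fintype.card B.Idx := Nat.cast_pos.2 Fintype.card_pos
  have hε : (ε : ℂ) = (d * c)⁻¹ := by simp [ε, d]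
  have hε0 : 0 < ε := inv_pos.2 (mul_pos hcard hc)
  have htr : ∀ i j, ∑ a, H' (i, a) (j, a) = 0 := by
    intro i j
    simp only [H', Matrix.sub_apply, Matrix.smul_apply, kron_apply, Matrix.one_apply_eq, mul_one,
      Finset.sum_sub_distrib, Finset.sum_const, Finset.card_univ, smul_eq_mul, nsmul_eq_mul]
    rw [← hd_def, mul_inv_cancel_left₀ hd]
    exact sub_self _
  refine ⟨ofChoi ((ε : ℂ) • ((c : ℂ) • 1 + H')), ⟨?_, ?_⟩, ε, hε0,
    ((ε : ℂ) * (c * Fintype.card A.Idx - d⁻¹ * R.trace)).re, fun Φ hΦ => ?_⟩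
  · rw [isCP_iff_choi_posSemidef, choi_ofChoi]
    exact hpos.smul (by exact_mod_cast hε0.le)
  · rw [isTP_iff_choi]
    intro i j
    rw [choi_ofChoi]
    simp only [Matrix.smul_apply, Matrix.add_apply, smul_eq_mul, ← Finset.mul_sum,
      Finset.sum_add_distrib, htr, add_zero]
    rw [hε]
    by_cases h : i = j
    · subst h
      simp only [Matrix.one_apply_eq, Finset.sum_const, Finset.card_univ, nsmul_eq_mul, if_true,
        mul_one]
      rw [← hd_def]
      field_simp
    · simp [h]
  · have hk : (kron R (1 : B.Op) * choi Φ).trace = R.trace := by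
      calc (kron R (1 : B.Op) * choi Φ).trace
          = ∑ i, ∑ a, ∑ j, ∑ b, R i j * (1 : B.Op) a b * choi Φ (j, b) (i, a) := by
            simp only [Matrix.trace, Matrix.diag_apply, Matrix.mul_apply]
            rw [Fintype.sum_prod_type]
            refine Finset.sum_congr rfl fun i _ => Finset.sum_congr rfl fun a _ => ?_
            rw [Fintype.sum_prod_type]
            rfl
        _ = ∑ i, ∑ j, R i j * ∑ a, choi Φ (j, a) (i, a) := by
            refine Finset.sum_congr rfl fun i _ => ?_
            rw [Finset.sum_comm]
            simp only [Finset.mul_sum]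
            simp [Matrix.one_apply]
        _ = R.trace := by
            simp only [isTP_iff_choi.1 hΦ]
            simp [Matrix.trace]
    rw [choi_ofChoi, Matrix.smul_mul, Matrix.add_mul, Matrix.smul_mul, Matrix.one_mul,
      Matrix.sub_mul, Matrix.smul_mul, Matrix.trace_smul, Matrix.trace_add, Matrix.trace_smul,
      Matrix.trace_sub, Matrix.trace_smul, hk, hΦ.trace_choi, ← Complex.re_ofReal_mul,
      ← Complex.add_re]
    congr 1
    simp only [smul_eq_mul]
    ring

/-! ### The measures `E_P` -/

section Measures

variable {A₀ A₁ B₀ B₁ C₀ C₁ D₀ D₁ : QSys}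

theorem nonempty_values (P : Map (C₀.tensor D₀) (C₁.tensor D₁))
    (N : Map (A₀.tensor B₀) (A₁.tensor B₁)) : (values P N).Nonempty := by
  obtain ⟨Θ, hΘ⟩ := exists_isLOCCSuperchannel A₀ A₁ B₀ B₁ C₀ C₁ D₀ D₁
  exact ⟨_, Θ, hΘ, rfl⟩

theorem bddAbove_values (P : Map (C₀.tensor D₀) (C₁.tensor D₁))
    (N : Map (A₀.tensor B₀) (A₁.tensor B₁)) : BddAbove (values P N) := by
  obtain ⟨C, hC⟩ := exists_bound (C₀ := C₀) (C₁ := C₁) (D₀ := D₀) (D₁ := D₁) N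
  refine ⟨∑ p, ∑ q, ‖choi P p q‖ * C, ?_⟩
  rintro _ ⟨Θ, hΘ, rfl⟩
  refine (Complex.re_le_norm _).trans ((norm_sum_le _ _).trans (Finset.sum_le_sum fun p _ => ?_))
  rw [Matrix.diag_apply, Matrix.mul_apply]
  refine (norm_sum_le _ _).trans (Finset.sum_le_sum fun q _ => ?_)
  rw [norm_mul]
  exact mul_le_mul_of_nonneg_left (hC Θ hΘ q p) (norm_nonneg _)

theorem le_E {P : Map (C₀.tensor D₀) (C₁.tensor D₁)} {N : Map (A₀.tensor B₀) (A₁.tensor B₁)}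
    {Θ : SMap (A₀.tensor B₀) (A₁.tensor B₁) (C₀.tensor D₀) (C₁.tensor D₁)}
    (hΘ : IsLOCCSuperchannel Θ) : (choi P * choi (Θ N)).trace.re ≤ E P N :=
  le_csSup (bddAbove_values P N) ⟨Θ, hΘ, rfl⟩

theorem E_le {P : Map (C₀.tensor D₀) (C₁.tensor D₁)} {N : Map (A₀.tensor B₀) (A₁.tensor B₁)}
    {x : ℝ} (h : ∀ Θ : SMap (A₀.tensor B₀) (A₁.tensor B₁) (C₀.tensor D₀) (C₁.tensor D₁),
      IsLOCCSuperchannel Θ → (choi P * choi (Θ N)).trace.re ≤ x) : E P N ≤ x :=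
  csSup_le (nonempty_values P N) (by rintro _ ⟨Θ, hΘ, rfl⟩; exact h Θ hΘ)

/-- `E P` is convex as a supremum of functions that are linear in `N`. -/
theorem convexOn_E (P : Map (C₀.tensor D₀) (C₁.tensor D₁)) :
    ConvexOn ℝ {N : Map (A₀.tensor B₀) (A₁.tensor B₁) | IsChannel N} fun N => E P N := by
  refine ⟨convex_isChannel _ _, fun N _ M _ a b ha hb _ => E_le fun Θ hΘ => ?_⟩
  have h : choi (Θ (a • N + b • M)) = (a : ℂ) • choi (Θ N) + (b : ℂ) • choi (Θ M) := by
    change choi (Θ ((a : ℂ) • N + (b : ℂ) • M)) = _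
    rw [map_add, map_smul, map_smul, ← choiEquiv_apply, map_add, map_smul, map_smul]
    rfl
  rw [h, Matrix.mul_add, Matrix.mul_smul, Matrix.mul_smul, Matrix.trace_add, Matrix.trace_smul,
    Matrix.trace_smul, Complex.add_re, smul_eq_mul, smul_eq_mul, Complex.re_ofReal_mul,
    Complex.re_ofReal_mul]
  exact add_le_add (mul_le_mul_of_nonneg_left (le_E hΘ) ha)
    (mul_le_mul_of_nonneg_left (le_E hΘ) hb)

theorem E_apply_le {K₀ K₁ L₀ L₁ : QSys} (P : Map (K₀.tensor L₀) (K₁.tensor L₁))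
    {Θ : SMap (A₀.tensor B₀) (A₁.tensor B₁) (C₀.tensor D₀) (C₁.tensor D₁)}
    (hΘ : IsLOCCSuperchannel Θ) (N : Map (A₀.tensor B₀) (A₁.tensor B₁)) :
    E P (Θ N) ≤ E P N :=
  E_le fun _ hΞ => le_E (hΞ.comp hΘ)

theorem LOCCConvertible.E_le {N : Map (A₀.tensor B₀) (A₁.tensor B₁)}
    {M : Map (C₀.tensor D₀) (C₁.tensor D₁)} (h : LOCCConvertible N M) {K₀ K₁ L₀ L₁ : QSys}
    (P : Map (K₀.tensor L₀) (K₁.tensor L₁)) : E P M ≤ E P N := by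
  obtain ⟨Θ, ⟨Ξ, hΞ, hlim⟩, rfl⟩ := h
  refine DynEnt.E_le fun Υ hΥ => ?_
  have hchoi : Tendsto (fun n => choi (Ξ n N)) atTop (𝓝 (choi (Θ N))) := by
    refine tendsto_pi_nhds.2 fun p => tendsto_pi_nhds.2 fun q => ?_
    simp only [choi_apply]
    exact tendsto_pi_nhds.1 (tendsto_pi_nhds.1 (hlim N (matUnit _ p.1 q.1)) p.2) q.2
  have hcont : Continuous ((choiEquiv _ _).toLinearMap ∘ₗ Υ ∘ₗ (choiEquiv _ _).symm.toLinearMap) :=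
    LinearMap.continuous_of_finiteDimensional _
  have h1 : Tendsto (fun n => choi (Υ (Ξ n N))) atTop (𝓝 (choi (Υ (Θ N)))) := by
    have := (hcont.tendsto _).comp hchoi
    simpa only [Function.comp_def, LinearMap.comp_apply, LinearEquiv.coe_coe,
      choiEquiv_symm_apply, ofChoi_choi, choiEquiv_apply] using this
  have hcont' : Continuous fun X : ((K₀.tensor L₀).tensor (K₁.tensor L₁)).Op =>
      (choi P * X).trace.re := by fun_prop
  exact le_of_tendsto' ((hcont'.tendsto _).comp h1) fun n => le_E (hΥ.comp (hΞ n))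

/-- If `M` is not reached from `N`, it is separated from the compact convex set of the channels
reached, and the separating functional is given by a channel `P` with `E P N < E P M`. -/
theorem loccConvertible_of_forall_E_le {N : Map (A₀.tensor B₀) (A₁.tensor B₁)}
    {M : Map (C₀.tensor D₀) (C₁.tensor D₁)} (hN : IsChannel N) (hM : IsChannel M)
    (h : ∀ P : Map (C₀.tensor D₀) (C₁.tensor D₁), IsChannel P → E P M ≤ E P N) :
    LOCCConvertible N M := by
  by_contra hnot
  have hmem := mt loccConvertible_of_mem hnot
  have hcompact := (isCompact_loccClosure A₀ A₁ B₀ B₁ C₀ C₁ D₀ D₁).image (continuous_superEval N)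
  have hconvex := (convex_loccClosure A₀ A₁ B₀ B₁ C₀ C₁ D₀ D₁).linear_image
    ((superEval _ _ N).restrictScalars ℝ)
  obtain ⟨f, u, hfu, huf⟩ := geometric_hahn_banach_closed_point hconvex hcompact.isClosed hmem
  obtain ⟨W, hW⟩ := exists_eq_re_trace_mul f.toLinearMap
  -- on Hermitian matrices `W` may be replaced by its Hermitian part
  have hWH : ∀ Φ : Map (C₀.tensor D₀) (C₁.tensor D₁), IsChannel Φ →
      ((W + W.conjTranspose) * choi Φ).trace.re = 2 * f (choi Φ) := by
    intro Φ hΦ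
    have h1 := re_trace_conjTranspose_mul W ((isCP_iff_choi_posSemidef Φ).1 hΦ.1).isHermitian
    have h2 : f (choi Φ) = (W * choi Φ).trace.re := hW (choi Φ)
    rw [Matrix.add_mul, Matrix.trace_add, Complex.add_re, h1, h2, two_mul]
  obtain ⟨P, hP, ε, hε, c, hPc⟩ := exists_isChannel_trace_mul_choi
    (Matrix.isHermitian_add_transpose_self W)
  have h1 : E P N ≤ ε * (2 * u) + c := E_le fun Θ hΘ => by
    rw [hPc _ (hΘ.isTP hN.2), hWH _ (hΘ.isChannel hN)]
    have : f (choi (Θ N)) < u := hfu _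
      ⟨superChoi _ _ _ _ Θ, subset_closure ⟨Θ, hΘ, rfl⟩, superEval_superChoi N Θ⟩
    gcongr
  have h2 : ε * (2 * f (choi M)) + c ≤ E P M := by
    rw [← hWH M hM, ← hPc M hM.2]
    exact le_E (Θ := LinearMap.id) (isLOCCSuperchannel_id C₀ C₁ D₀ D₁)
  have h3 : ε * (2 * u) < ε * (2 * f (choi M)) := by gcongr
  linarith [h P hP]

end Measures

end DynEnt

theorem theorem1 :
    -- each `E_P` is a well-defined (finite) convex measure of dynamical entanglement
    (∀ (K₀ K₁ L₀ L₁ : QSys) (P : QSys.Map (K₀.tensor L₀) (K₁.tensor L₁)), DynEnt.IsChannel P →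
      ∀ A₀ A₁ B₀ B₁ : QSys,
        (∀ N : QSys.Map (A₀.tensor B₀) (A₁.tensor B₁), DynEnt.IsChannel N →
          (DynEnt.values P N).Nonempty ∧ BddAbove (DynEnt.values P N)) ∧
        ConvexOn ℝ {N : QSys.Map (A₀.tensor B₀) (A₁.tensor B₁) | DynEnt.IsChannel N}
          (fun N => DynEnt.E P N) ∧
        (∀ (C₀ C₁ D₀ D₁ : QSys)
          (Θ : QSys.SMap (A₀.tensor B₀) (A₁.tensor B₁) (C₀.tensor D₀) (C₁.tensor D₁)),
          DynEnt.IsLOCCSuperchannel Θ →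
          ∀ N : QSys.Map (A₀.tensor B₀) (A₁.tensor B₁), DynEnt.IsChannel N →
            DynEnt.E P (Θ N) ≤ DynEnt.E P N)) ∧
    -- the family is complete
    (∀ (A₀ A₁ B₀ B₁ C₀ C₁ D₀ D₁ : QSys)
      (N : QSys.Map (A₀.tensor B₀) (A₁.tensor B₁)) (M : QSys.Map (C₀.tensor D₀) (C₁.tensor D₁)),
      DynEnt.IsChannel N → DynEnt.IsChannel M →
      -- with `P` ranging over all bipartite channels, between arbitrary systems
      (DynEnt.LOCCConvertible N M ↔
        ∀ (K₀ K₁ L₀ L₁ : QSys) (P : QSys.Map (K₀.tensor L₀) (K₁.tensor L₁)),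
          DynEnt.IsChannel P → DynEnt.E P N ≥ DynEnt.E P M) ∧
      -- and already with `P` ranging over the bipartite channels between the systems of `M`
      (DynEnt.LOCCConvertible N M ↔
        ∀ P : QSys.Map (C₀.tensor D₀) (C₁.tensor D₁),
          DynEnt.IsChannel P → DynEnt.E P N ≥ DynEnt.E P M)) := by
  refine ⟨fun K₀ K₁ L₀ L₁ P _ A₀ A₁ B₀ B₁ =>
      ⟨fun N _ => ⟨DynEnt.nonempty_values P N, DynEnt.bddAbove_values P N⟩, DynEnt.convexOn_E P,
        fun C₀ C₁ D₀ D₁ Θ hΘ N _ => DynEnt.E_apply_le P hΘ N⟩,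
    fun A₀ A₁ B₀ B₁ C₀ C₁ D₀ D₁ N M hN hM =>
      ⟨⟨fun h K₀ K₁ L₀ L₁ P _ => h.E_le P, fun h => ?_⟩, fun h P _ => h.E_le P, fun h => ?_⟩⟩
  · exact DynEnt.loccConvertible_of_forall_E_le hN hM (h _ _ _ _)
  · exact DynEnt.loccConvertible_of_forall_E_le hN hM h
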